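/- For $\beta\in\mathbb R$ let $\mathcal D_\beta(\mathbb D)$ be the Hilbert space of analytic functions $f(z)=\sum_{n\ge 0}a_nz^n$ on the open unit disc $\mathbb D$ with $$\|f\|_\beta^2=\sum_{n\ge 0}|a_n|^2(n+1)^{2\beta}<\infty .$$ For $0<r<1$ let $\varphi_r(z)=\frac{z+r}{1+rz}$, a hyperbolic automorphism of $\mathbb D$, and let $C_{\varphi_r}f=f\circ\varphi_r$. A bounded operator $U$ on a Hilbert space $H$ is called universal if for every bounded operator $T$ on $H$ there are a closed subspace $M\subset H$ with $U(M)\subset M$ and a constant $c\neq 0$ such that $U|_M:M\to M$ is similar to $cT$, that is, $U|_M=J^{-1}(cT)J$ for some bounded, boundedly invertible linear bijection $J:M\to H$. Let $0<r<1$ and $\beta\ge 1/2$. Then $C_{\varphi_r}$ is a bounded operator on $\mathcal D_\beta(\mathbb D)$, and $C_{\varphi_r}-\lambda I$ is not universal on $\mathcal D_\beta(\mathbb D)$ for any $\lambda\in\mathbb C$. Moreover: (i) if $\beta=1/2$, then the spectrum of $C_{\varphi_r}$ on $\mathcal D_{1/2}(\mathbb D)$ is the unit circle $\mathbb T$, and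 the adjoint $C_{\varphi_r}^*-\overline{\lambda}I$ is not universal on $\mathcal D_{1/2}(\mathbb D)$ for any $\lambda\in\mathbb C$ either; (ii) if $\beta>1/2$, then $1$ is the only eigenvalue of $C_{\varphi_r}$ on $\mathcal D_\beta(\mathbb D)$, and $\operatorname{Ker}(C_{\varphi_r}-I)$ is the one-dimensional space of constant functions. -/

import Mathlib

open scoped Complex.UnitDisc ComplexConjugate

/-- Two bounded operators are similar if a (bounded, boundedly invertible) linear isomorphism `J`
satisfies `T₁ = J⁻¹ T₂ J`. -/
def IsSimilar {H₁ H₂ : Type*} [NormedAddCommGroup H₁] [NormedSpace ℂ H₁]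
    [NormedAddCommGroup H₂] [NormedSpace ℂ H₂] (T₁ : H₁ →L[ℂ] H₁) (T₂ : H₂ →L[ℂ] H₂) : Prop :=
  ∃ J : H₁ ≃L[ℂ] H₂, T₁ = (J.symm : H₂ →L[ℂ] H₁) ∘L T₂ ∘L (J : H₁ →L[ℂ] H₂)

/-- `U` is universal for `H`: every bounded operator `T` on `H` has a nonzero multiple `c T` that is
similar to the restriction of `U` to some closed `U`-invariant subspace `M`. -/
def IsUniversalOperator {H : Type*} [NormedAddCommGroup H] [NormedSpace ℂ H]
    (U : H →L[ℂ] H) : Prop :=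
  ∀ T : H →L[ℂ] H, ∃ (M : Submodule ℂ H) (hM : Set.MapsTo U M M) (c : ℂ),
    IsClosed (M : Set H) ∧ c ≠ 0 ∧ IsSimilar (U.restrict hM) (c • T)

/-- The functions `f(z) = ∑ aₙ zⁿ` on the open unit disc with `∑ |aₙ|² (n+1)^(2β) < ∞`. -/
def weightedDirichletSubmodule (β : ℝ) : Submodule ℂ (𝔻 → ℂ) where
  carrier := {f | ∃ a : ℕ → ℂ, Summable (fun n : ℕ => ‖a n‖ ^ 2 * ((n : ℝ) + 1) ^ (2 * β)) ∧
    ∀ z : 𝔻, HasSum (fun n : ℕ => a n * (z : ℂ) ^ n) (f z)}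
  zero_mem' := ⟨0, by simp, fun z => by simp⟩
  add_mem' := by
    rintro f g ⟨a, ha, hf⟩ ⟨b, hb, hg⟩
    refine ⟨a + b, ?_, fun z => ?_⟩
    · refine Summable.of_nonneg_of_le (fun n => by positivity) (fun n => ?_)
        ((ha.add hb).mul_left 2)
      have h1 : ‖a n + b n‖ ^ 2 ≤ 2 * (‖a n‖ ^ 2 + ‖b n‖ ^ 2) := by
        nlinarith [norm_add_le (a n) (b n), norm_nonneg (a n + b n), norm_nonneg (a n),
          norm_nonneg (b n), sq_nonneg (‖a n‖ - ‖b n‖)]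
      have h2 : 0 ≤ ((n : ℝ) + 1) ^ (2 * β) := by positivity
      have := mul_le_mul_of_nonneg_right h1 h2
      simp only [Pi.add_apply]
      linarith
    · simpa [add_mul] using (hf z).add (hg z)
  smul_mem' := by
    rintro c f ⟨a, ha, hf⟩
    refine ⟨c • a, ?_, fun z => ?_⟩
    · simpa [mul_pow, mul_assoc] using ha.mul_left (‖c‖ ^ 2)
    · simpa [mul_assoc] using (hf z).mul_left c

/-- The weighted Dirichlet space `D_β(𝔻)`. It is a type of its own, so that its topology is the one
of its norm and not the topology of pointwise convergence. -/
def WeightedDirichlet (β : ℝ) : Type := ↥(weightedDirichletSubmodule β)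

namespace WeightedDirichlet

variable {β : ℝ}

noncomputable instance : AddCommGroup (WeightedDirichlet β) :=
  inferInstanceAs (AddCommGroup ↥(weightedDirichletSubmodule β))

noncomputable instance : Module ℂ (WeightedDirichlet β) :=
  inferInstanceAs (Module ℂ ↥(weightedDirichletSubmodule β))

instance : CoeFun (WeightedDirichlet β) (fun _ => 𝔻 → ℂ) := ⟨Subtype.val⟩

@[ext] theorem ext {f g : WeightedDirichlet β} (h : ∀ z, f z = g z) : f = g :=
  Subtype.ext (funext h)

@[simp] theorem add_apply (f g : WeightedDirichlet β) (z : 𝔻) : (f + g) z = f z + g z := rfl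

@[simp] theorem smul_apply (c : ℂ) (f : WeightedDirichlet β) (z : 𝔻) : (c • f) z = c * f z := rfl

/-- The Taylor coefficients of `f` at the origin. -/
noncomputable def coeff (f : WeightedDirichlet β) : ℕ → ℂ := f.2.choose

theorem summable_coeff (f : WeightedDirichlet β) :
    Summable (fun n : ℕ => ‖f.coeff n‖ ^ 2 * ((n : ℝ) + 1) ^ (2 * β)) := f.2.choose_spec.1

theorem hasSum_coeff (f : WeightedDirichlet β) (z : 𝔻) :
    HasSum (fun n : ℕ => f.coeff n * (z : ℂ) ^ n) (f z) := f.2.choose_spec.2 z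

theorem coeff_unique (f : WeightedDirichlet β) {a : ℕ → ℂ}
    (ha : ∀ z : 𝔻, HasSum (fun n : ℕ => a n * (z : ℂ) ^ n) (f z)) : f.coeff = a := by
  have h : HasFPowerSeriesAt (fun _ : ℂ => (0 : ℂ))
      (FormalMultilinearSeries.ofScalars ℂ (f.coeff - a)) 0 := by
    rw [hasFPowerSeriesAt_iff]
    filter_upwards [Metric.ball_mem_nhds (0 : ℂ) one_pos] with z hz
    have := (f.hasSum_coeff (.mk z (by simpa using hz))).sub (ha (.mk z (by simpa using hz)))
    simpa [mul_sub, mul_comm] using this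
  have h0 := h.eq_zero
  funext n
  have h1 : (f.coeff - a) n = (0 : FormalMultilinearSeries ℂ ℂ ℂ).coeff n := by
    rw [← h0, FormalMultilinearSeries.coeff_ofScalars]
  exact sub_eq_zero.1 h1

theorem coeff_add (f g : WeightedDirichlet β) : (f + g).coeff = f.coeff + g.coeff :=
  coeff_unique _ fun z => by simpa [add_mul] using (f.hasSum_coeff z).add (g.hasSum_coeff z)

theorem coeff_smul (c : ℂ) (f : WeightedDirichlet β) : (c • f).coeff = c • f.coeff :=
  coeff_unique _ fun z => by simpa [mul_assoc] using (f.hasSum_coeff z).mul_left c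

/-- A weighted square summable sequence of coefficients is the one of some element. -/
theorem exists_coeff_eq (a : ℕ → ℂ)
    (ha : Summable (fun n : ℕ => ‖a n‖ ^ 2 * ((n : ℝ) + 1) ^ (2 * β))) :
    ∃ f : WeightedDirichlet β, f.coeff = a := by
  have key : ∀ z : 𝔻, Summable (fun n : ℕ => a n * (z : ℂ) ^ n) := by
    intro z
    obtain ⟨k, hk⟩ := exists_nat_ge (-β)
    obtain ⟨C, hC⟩ := ha.tendsto_atTop_zero.bddAbove_range
    have hz : ‖(‖(z : ℂ)‖ : ℝ)‖ < 1 := by simpa using z.norm_lt_one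
    have hs : Summable (fun n : ℕ => ((n : ℝ) + 1) ^ k * ‖(z : ℂ)‖ ^ n) := by
      have h1 : Summable (fun n : ℕ => (2 : ℝ) ^ k * ((n : ℝ) ^ k * ‖(z : ℂ)‖ ^ n)) :=
        (summable_pow_mul_geometric_of_norm_lt_one k hz).mul_left _
      refine (summable_nat_add_iff 1).1 (Summable.of_nonneg_of_le (fun n => by positivity)
        (fun n => ?_) ((summable_nat_add_iff 1).2 h1))
      rw [← mul_assoc, ← mul_pow]
      gcongr
      push_cast
      have : (0 : ℝ) ≤ n := n.cast_nonneg
      linarith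
    refine Summable.of_norm_bounded (hs.mul_left (Real.sqrt C)) fun n => ?_
    have hn : ‖a n‖ ^ 2 * ((n : ℝ) + 1) ^ (2 * β) ≤ C := hC ⟨n, rfl⟩
    have hpos : (0 : ℝ) < (n : ℝ) + 1 := by positivity
    have h2 : ‖a n‖ * ((n : ℝ) + 1) ^ β ≤ Real.sqrt C := by
      apply Real.le_sqrt_of_sq_le
      rwa [mul_pow, ← Real.rpow_natCast (((n : ℝ) + 1) ^ β), ← Real.rpow_mul hpos.le,
        Nat.cast_ofNat, mul_comm β]
    have h3 : ((n : ℝ) + 1) ^ (-β) ≤ ((n : ℝ) + 1) ^ k := by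
      rw [← Real.rpow_natCast]
      exact Real.rpow_le_rpow_of_exponent_le (by linarith [(n.cast_nonneg : (0 : ℝ) ≤ n)]) hk
    have h4 : ‖a n‖ = ‖a n‖ * ((n : ℝ) + 1) ^ β * ((n : ℝ) + 1) ^ (-β) := by
      rw [mul_assoc, ← Real.rpow_add hpos]
      simp
    rw [norm_mul, norm_pow, ← mul_assoc]
    gcongr
    rw [h4]
    gcongr
  exact ⟨⟨fun z => ∑' n : ℕ, a n * (z : ℂ) ^ n, a, ha, fun z => (key z).hasSum⟩,
    coeff_unique _ fun z => (key z).hasSum⟩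

/-- The coordinates `aₙ (n+1)^β`. -/
noncomputable def weightedCoeff (f : WeightedDirichlet β) (n : ℕ) : ℂ :=
  (((n : ℝ) + 1) ^ β : ℝ) * f.coeff n

theorem norm_weightedCoeff_sq (f : WeightedDirichlet β) (n : ℕ) :
    ‖f.weightedCoeff n‖ ^ 2 = ‖f.coeff n‖ ^ 2 * ((n : ℝ) + 1) ^ (2 * β) := by
  have hpos : (0 : ℝ) < (n : ℝ) + 1 := by positivity
  rw [weightedCoeff, norm_mul, Complex.norm_real, Real.norm_of_nonneg (by positivity), mul_pow,
    ← Real.rpow_natCast (((n : ℝ) + 1) ^ β), ← Real.rpow_mul hpos.le, Nat.cast_ofNat, mul_comm β,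
    mul_comm]

/-- The linear identification `f ↦ (aₙ (n+1)^β)ₙ` of `D_β(𝔻)` with `ℓ²`. -/
noncomputable def toL2 (β : ℝ) : WeightedDirichlet β →ₗ[ℂ] lp (fun _ : ℕ => ℂ) 2 where
  toFun f := ⟨f.weightedCoeff, memℓp_gen (by simpa [norm_weightedCoeff_sq] using f.summable_coeff)⟩
  map_add' f g := by
    ext n
    change (f + g).weightedCoeff n = f.weightedCoeff n + g.weightedCoeff n
    simp [weightedCoeff, coeff_add, mul_add]
  map_smul' c f := by
    ext n
    simp [weightedCoeff, coeff_smul, mul_left_comm]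

theorem toL2_apply (f : WeightedDirichlet β) (n : ℕ) : toL2 β f n = f.weightedCoeff n := rfl

theorem toL2_injective : Function.Injective (toL2 β) := by
  intro f g h
  have hc : f.coeff = g.coeff := by
    funext n
    have h1 : f.weightedCoeff n = g.weightedCoeff n := by rw [← toL2_apply, h, toL2_apply]
    have hpos : (((n : ℝ) + 1) ^ β : ℝ) ≠ 0 := by positivity
    exact mul_left_cancel₀ (Complex.ofReal_ne_zero.2 hpos) h1
  ext z
  exact (f.hasSum_coeff z).unique (hc ▸ g.hasSum_coeff z)

theorem toL2_surjective : Function.Surjective (toL2 β) := by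
  intro b
  have hb : Summable (fun n => ‖b n‖ ^ 2) := by
    simpa using (lp.memℓp b).summable (by simp)
  have hne : ∀ n : ℕ, (((n : ℝ) + 1) ^ β : ℝ) ≠ 0 := fun n => by positivity
  obtain ⟨f, hf⟩ := exists_coeff_eq (β := β)
    (fun n : ℕ => ((((n : ℝ) + 1) ^ β : ℝ) : ℂ)⁻¹ * b n) (by
      refine hb.congr fun n => ?_
      have hpos : (0 : ℝ) < (n : ℝ) + 1 := by positivity
      rw [norm_mul, norm_inv, Complex.norm_real, Real.norm_of_nonneg (by positivity), mul_pow,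
        inv_pow, two_mul, Real.rpow_add hpos, ← sq]
      field_simp [hne n])
  refine ⟨f, ?_⟩
  ext n
  rw [toL2_apply, weightedCoeff, hf]
  exact mul_inv_cancel_left₀ (Complex.ofReal_ne_zero.2 (hne n)) _

/-- The inner product `⟪f, g⟫ = ∑ conj(aₙ) bₙ (n+1)^(2β)` for `f = ∑ aₙ zⁿ`, `g = ∑ bₙ zⁿ`
(conjugate linear in the first argument, as everywhere in Mathlib). -/
noncomputable instance : Inner ℂ (WeightedDirichlet β) :=
  ⟨fun f g => ∑' n : ℕ, conj (f.coeff n) * g.coeff n * (((n : ℝ) + 1) ^ (2 * β) : ℝ)⟩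

theorem inner_def (f g : WeightedDirichlet β) : inner ℂ f g =
    ∑' n : ℕ, conj (f.coeff n) * g.coeff n * (((n : ℝ) + 1) ^ (2 * β) : ℝ) := rfl

theorem inner_eq_inner_toL2 (f g : WeightedDirichlet β) :
    inner ℂ f g = inner ℂ (toL2 β f) (toL2 β g) := by
  rw [inner_def, lp.inner_eq_tsum]
  refine tsum_congr fun n => ?_
  have hpos : (0 : ℝ) < (n : ℝ) + 1 := by positivity
  simp only [toL2_apply, weightedCoeff, RCLike.inner_apply, map_mul, Complex.conj_ofReal, two_mul,
    Real.rpow_add hpos, Complex.ofReal_mul]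
  ring

/-- The inner product space axioms. -/
@[reducible]
noncomputable def core (β : ℝ) : InnerProductSpace.Core ℂ (WeightedDirichlet β) where
  conj_inner_symm f g := by
    rw [inner_eq_inner_toL2, inner_eq_inner_toL2]; exact inner_conj_symm _ _
  re_inner_nonneg f := by
    rw [inner_eq_inner_toL2]; exact inner_self_nonneg
  add_left f g h := by
    simp only [inner_eq_inner_toL2, map_add]; exact inner_add_left _ _ _
  smul_left f g c := by
    simp only [inner_eq_inner_toL2, map_smul]; exact inner_smul_left _ _ _
  definite f hf := by
    rw [inner_eq_inner_toL2, inner_self_eq_zero] at hf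
    exact toL2_injective (by rw [hf, map_zero])

noncomputable instance : NormedAddCommGroup (WeightedDirichlet β) :=
  (core β).toNormedAddCommGroup

noncomputable instance : InnerProductSpace ℂ (WeightedDirichlet β) :=
  InnerProductSpace.ofCore (core β).toCore

/-- `D_β(𝔻)` is isometrically isomorphic to `ℓ²`. -/
noncomputable def isometryEquivL2 (β : ℝ) :
    WeightedDirichlet β ≃ₗᵢ[ℂ] lp (fun _ : ℕ => ℂ) 2 where
  toLinearEquiv := LinearEquiv.ofBijective (toL2 β) ⟨toL2_injective, toL2_surjective⟩
  norm_map' f := by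
    rw [@norm_eq_sqrt_re_inner ℂ, @norm_eq_sqrt_re_inner ℂ, inner_eq_inner_toL2]
    rfl

instance : CompleteSpace (WeightedDirichlet β) :=
  (isometryEquivL2 β).toIsometryEquiv.completeSpace

/-- The norm is `‖f‖² = ∑ |aₙ|² (n+1)^(2β)`. -/
theorem norm_sq_eq (f : WeightedDirichlet β) :
    ‖f‖ ^ 2 = ∑' n : ℕ, ‖f.coeff n‖ ^ 2 * ((n : ℝ) + 1) ^ (2 * β) := by
  rw [← (isometryEquivL2 β).norm_map f]
  have := lp.norm_rpow_eq_tsum (p := 2) (by simp) (isometryEquivL2 β f)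
  simp only [ENNReal.toReal_ofNat, Real.rpow_ofNat] at this
  rw [this]
  exact tsum_congr fun n => norm_weightedCoeff_sq f n

/-- `C` is the composition operator `f ↦ f ∘ φ` on `D_β(𝔻)`. -/
def IsCompositionOperator (φ : 𝔻 → 𝔻) (C : WeightedDirichlet β →L[ℂ] WeightedDirichlet β) : Prop :=
  ∀ (f : WeightedDirichlet β) (z : 𝔻), C f z = f (φ z)

end WeightedDirichlet

/-- The hyperbolic automorphism `z ↦ (z + r) / (1 + r z)` of the unit disc, for `0 < r < 1`. -/
noncomputable def hyperbolicAut (r : ℝ) (h0 : 0 < r) (h1 : r < 1) (z : 𝔻) : 𝔻 :=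
  .mk (((z : ℂ) + r) / (1 + r * z)) (by
    have hz := z.normSq_lt_one
    have hr : r ^ 2 < 1 := by nlinarith
    have hlt : Complex.normSq ((z : ℂ) + r) < Complex.normSq (1 + r * (z : ℂ)) := by
      simp only [Complex.normSq_apply, Complex.add_re, Complex.add_im, Complex.mul_re,
        Complex.mul_im, Complex.ofReal_re, Complex.ofReal_im, Complex.one_re,
        Complex.one_im] at hz ⊢
      nlinarith [mul_pos (sub_pos.2 hz) (sub_pos.2 hr)]
    have hpos := (Complex.normSq_nonneg ((z : ℂ) + r)).trans_lt hlt
    have h : ‖((z : ℂ) + r) / (1 + r * z)‖ ^ 2 < 1 := by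
      rw [← Complex.normSq_eq_norm_sq, Complex.normSq_div, div_lt_one hpos]
      exact hlt
    exact (sq_lt_one_iff₀ (norm_nonneg _)).1 h)

/-!
Write `r = tanh t`. The automorphisms `discFlow t : z ↦ (z + tanh t) / (1 + tanh t · z)` form a
one-parameter group, and `f ∘ discFlow t` solves the transport equation `∂ₜ f = (1 - z²) f'`. On
Taylor coefficients this reads `aₙ' = (n + 1) aₙ₊₁ - (n - 1) aₙ₋₁`, so summation by parts gives
`d/dt ∑ wₙ |aₙ|² = 2 ∑ ((n + 1) wₙ - n wₙ₊₁) Re (conj aₙ · aₙ₊₁)`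
for any weight `w`, and Grönwall's inequality (`energy_le_exp_mul`) bounds the growth of the energy
as soon as `|(n + 1) wₙ - n wₙ₊₁| ≤ K √(wₙ wₙ₊₁)`. Three weights are used:

* `wₙ = (n + 1)^(2β)`, which makes the composition operators bounded on `D_β`; they are built by
  density of polynomials (`exists_comp_discFlow`);
* `wₙ = n` with `K = 0`, which makes the Dirichlet seminorm invariant (`dirichletEnergy_compFlow`);
* `w₀ = ε²` and `wₙ = n` otherwise, with `K = ε`; since its energy is an equivalent norm on
  `D_{1/2}`, the operators have subexponential growth there (`norm_compFlow_sq_le`), and the same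
  holds for their inverses, so that the spectrum lies on the unit circle.

As `t → ±∞`, `discFlow t` tends to the constant `±1`, and by invariance of the Dirichlet seminorm
`f ∘ discFlow t` tends weakly to zero modulo constants (`tendsto_coeff_succ_compFlow`). Hence all
eigenvectors are constant (`coeff_succ_eq_zero_of_eigenvector`), and on `D_{1/2}` the adjoint has no
eigenvector that annihilates the constants (`eq_zero_of_adjoint_eigenvector`). All the kernels of
`C - μ` and of its adjoint are therefore at most one-dimensional, whereas the kernel of a universal
operator contains a copy of the whole space (`not_isUniversalOperator_of_functional`).

Finally every `μ` on the unit circle is in the spectrum (`mem_spectrum_compFlow`): there are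
functionals `Λ` with `Λ (z ∘ discFlow s) = (cosh s)^(-2 (N + 1))`. If `(μ - C) u = z`, the sequence
`μ⁻ᵏ Λ (Cᵏ u)` tends to zero at both ends, jumps by one in modulus at `k = 0`, and for large `N`
has total variation less than one elsewhere, which is impossible.
-/

open Filter Topology
open scoped PowerSeries

/-! ### The flow of the vector field `(1 - z²) d/dz` on power series -/

/-- The derivation `(1 - z²) d/dz` of `ℂ⟦X⟧`, the infinitesimal generator of the group of hyperbolic
automorphisms fixing `1` and `-1`. -/
noncomputable def flowField (F : ℂ⟦X⟧) : ℂ⟦X⟧ :=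
  (1 - PowerSeries.X ^ 2) * PowerSeries.derivative ℂ F

theorem flowField_mul (F G : ℂ⟦X⟧) :
    flowField (F * G) = flowField F * G + F * flowField G := by
  simp only [flowField, Derivation.leibniz, smul_eq_mul]
  ring

theorem flowField_add (F G : ℂ⟦X⟧) : flowField (F + G) = flowField F + flowField G := by
  simp only [flowField, map_add, mul_add]

theorem flowField_C (c : ℂ) : flowField (PowerSeries.C c) = 0 := by
  simp [flowField]

theorem coeff_zero_flowField (F : ℂ⟦X⟧) :
    PowerSeries.coeff 0 (flowField F) = PowerSeries.coeff 1 F := by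
  rw [flowField, sub_mul, one_mul, map_sub, PowerSeries.coeff_X_pow_mul',
    PowerSeries.coeff_derivative]
  simp

theorem coeff_succ_flowField (F : ℂ⟦X⟧) (n : ℕ) :
    PowerSeries.coeff (n + 1) (flowField F) =
      (n + 2) * PowerSeries.coeff (n + 2) F - n * PowerSeries.coeff n F := by
  rw [flowField, sub_mul, one_mul, map_sub, PowerSeries.coeff_X_pow_mul',
    PowerSeries.coeff_derivative]
  rcases n with _ | n
  · simp; ring
  · simp [PowerSeries.coeff_derivative]
    ring

/-- A family of power series whose coefficients satisfy `∂ₜ F = (1 - z²) ∂_z F`. -/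
def IsFlowSolution (F : ℝ → ℂ⟦X⟧) : Prop :=
  ∀ t n, HasDerivAt (fun s => PowerSeries.coeff n (F s)) (PowerSeries.coeff n (flowField (F t))) t

theorem IsFlowSolution.mul {F G : ℝ → ℂ⟦X⟧} (hF : IsFlowSolution F) (hG : IsFlowSolution G) :
    IsFlowSolution (fun t => F t * G t) := by
  intro t n
  simp only [flowField_mul, map_add, PowerSeries.coeff_mul, ← Finset.sum_add_distrib]
  exact HasDerivAt.fun_sum fun p _ => (hF t p.1).mul (hG t p.2)

theorem IsFlowSolution.add {F G : ℝ → ℂ⟦X⟧} (hF : IsFlowSolution F) (hG : IsFlowSolution G) :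
    IsFlowSolution (fun t => F t + G t) := by
  intro t n
  simp only [flowField_add, map_add]
  exact (hF t n).add (hG t n)

theorem isFlowSolution_C (c : ℂ) : IsFlowSolution (fun _ => PowerSeries.C c) := by
  intro t n
  simpa only [flowField_C, map_zero] using hasDerivAt_const t _

/-- Coefficients bounded by a geometric sequence, locally uniformly in the parameter. -/
def IsLocallyGeometric (F : ℝ → ℂ⟦X⟧) : Prop :=
  ∀ T : ℝ, ∃ q M : ℝ, 0 ≤ q ∧ q < 1 ∧ 0 ≤ M ∧
    ∀ t, |t| ≤ T → ∀ n, ‖PowerSeries.coeff n (F t)‖ ≤ M * q ^ n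

theorem IsLocallyGeometric.add {F G : ℝ → ℂ⟦X⟧} (hF : IsLocallyGeometric F)
    (hG : IsLocallyGeometric G) : IsLocallyGeometric (fun t => F t + G t) := by
  intro T
  obtain ⟨q, M, hq0, hq1, hM, h⟩ := hF T
  obtain ⟨q', M', hq0', hq1', hM', h'⟩ := hG T
  refine ⟨max q q', M + M', le_max_of_le_left hq0, max_lt hq1 hq1', by positivity,
    fun t ht n => ?_⟩
  rw [map_add, add_mul]
  refine (norm_add_le _ _).trans (add_le_add ((h t ht n).trans ?_) ((h' t ht n).trans ?_))
  · gcongr; exact le_max_left _ _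
  · gcongr; exact le_max_right _ _

theorem isLocallyGeometric_C (c : ℂ) : IsLocallyGeometric (fun _ => PowerSeries.C c) := by
  intro T
  refine ⟨0, ‖c‖, le_rfl, one_pos, norm_nonneg _, fun t _ n => ?_⟩
  rcases n with _ | n <;> simp [PowerSeries.coeff_C]

theorem exists_succ_mul_pow_le {q : ℝ} (hq0 : 0 ≤ q) (hq1 : q < 1) :
    ∃ q' M : ℝ, 0 ≤ q' ∧ q' < 1 ∧ 0 ≤ M ∧ ∀ n : ℕ, ((n : ℝ) + 1) * q ^ n ≤ M * q' ^ n := by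
  have hs0 : 0 ≤ √q := Real.sqrt_nonneg q
  have hs1 : √q < 1 := by rw [Real.sqrt_lt' one_pos]; simpa using hq1
  have ht : Tendsto (fun n : ℕ => ((n : ℝ) ^ 1 * √q ^ n + √q ^ n)) atTop (𝓝 (0 + 0)) :=
    (tendsto_pow_const_mul_const_pow_of_abs_lt_one 1 (by rwa [abs_of_nonneg hs0])).add
      (tendsto_pow_atTop_nhds_zero_of_lt_one hs0 hs1)
  obtain ⟨M, hM⟩ := ht.bddAbove_range
  refine ⟨√q, M, hs0, hs1, ?_, fun n => ?_⟩
  · have := hM ⟨0, rfl⟩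
    simp at this
    linarith
  · have h := hM ⟨n, rfl⟩
    simp only [pow_one] at h
    calc ((n : ℝ) + 1) * q ^ n = ((n : ℝ) * √q ^ n + √q ^ n) * √q ^ n := by
          conv_lhs => rw [← Real.mul_self_sqrt hq0, mul_pow]
          ring
      _ ≤ M * √q ^ n := by gcongr

theorem IsLocallyGeometric.mul {F G : ℝ → ℂ⟦X⟧} (hF : IsLocallyGeometric F)
    (hG : IsLocallyGeometric G) : IsLocallyGeometric (fun t => F t * G t) := by
  intro T
  obtain ⟨q, M, hq0, hq1, hM, h⟩ := hF T
  obtain ⟨q', M', hq0', hq1', hM', h'⟩ := hG T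
  obtain ⟨r, L, hr0, hr1, hL, hr⟩ :=
    exists_succ_mul_pow_le (le_max_of_le_left (b := q) (c := q') hq0) (max_lt hq1 hq1')
  refine ⟨r, M * M' * L, hr0, hr1, by positivity, fun t ht n => ?_⟩
  rw [PowerSeries.coeff_mul]
  have hb : ∀ p ∈ Finset.HasAntidiagonal.antidiagonal n,
      ‖PowerSeries.coeff p.1 (F t) * PowerSeries.coeff p.2 (G t)‖ ≤ M * M' * max q q' ^ n := by
    intro p hp
    rw [norm_mul, ← Finset.HasAntidiagonal.mem_antidiagonal.1 hp, pow_add]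
    calc _ ≤ (M * q ^ p.1) * (M' * q' ^ p.2) :=
          mul_le_mul (h t ht _) (h' t ht _) (norm_nonneg _) (by positivity)
      _ ≤ (M * max q q' ^ p.1) * (M' * max q q' ^ p.2) := by
          gcongr
          · exact le_max_left _ _
          · exact le_max_right _ _
      _ = _ := by ring
  calc _ ≤ ∑ _p ∈ Finset.HasAntidiagonal.antidiagonal n, M * M' * max q q' ^ n :=
        norm_sum_le_of_le _ hb
    _ = M * M' * (((n : ℝ) + 1) * max q q' ^ n) := by
        rw [Finset.sum_const, Finset.Nat.card_antidiagonal, nsmul_eq_mul]; push_cast; ring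
    _ ≤ M * M' * (L * r ^ n) := mul_le_mul_of_nonneg_left (hr n) (by positivity)
    _ = _ := by ring

/-! ### The energy estimate -/

/-- Weights for which the energy `∑ wₙ |aₙ|²` grows at most like `exp (2 K |t|)` along the flow. The
condition `skew` bounds by `2 K` the sum of the generator `(1 - z²) d/dz` and its adjoint for the
weighted inner product; `growth` makes the energy of a geometric sequence finite. -/
structure IsFlowWeight (w : ℕ → ℝ) (K : ℝ) : Prop where
  nonneg : ∀ n, 0 ≤ w n
  const_nonneg : 0 ≤ K
  skew : ∀ n : ℕ, (((n : ℝ) + 1) * w n - n * w (n + 1)) ^ 2 ≤ K ^ 2 * (w n * w (n + 1))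
  growth : ∃ (k : ℕ) (W : ℝ), 0 ≤ W ∧ ∀ n : ℕ, w n ≤ W * ((n : ℝ) + 1) ^ k

theorem summable_succ_pow_mul_geometric (k : ℕ) {q : ℝ} (hq0 : 0 ≤ q) (hq1 : q < 1) :
    Summable (fun n : ℕ => ((n : ℝ) + 1) ^ k * q ^ n) := by
  have hq : ‖q‖ < 1 := by rwa [Real.norm_of_nonneg hq0]
  have h1 := ((summable_pow_mul_geometric_of_norm_lt_one k hq).add
    (summable_geometric_of_lt_one hq0 hq1)).mul_left ((2 : ℝ) ^ k)
  refine Summable.of_nonneg_of_le (fun n => by positivity) (fun n => ?_) h1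
  have h2 : ((n : ℝ) + 1) ^ k ≤ 2 ^ k * ((n : ℝ) ^ k + 1) := by
    rcases n with _ | n
    · simpa using (one_le_pow₀ one_le_two).trans
        (le_mul_of_one_le_right (by positivity) (by simp : (1 : ℝ) ≤ 0 ^ k + 1))
    · calc _ ≤ (2 * (((n + 1 : ℕ) : ℝ))) ^ k := by
            gcongr; push_cast; linarith [(n.cast_nonneg : (0 : ℝ) ≤ n)]
        _ = 2 ^ k * ((n + 1 : ℕ) : ℝ) ^ k := mul_pow _ _ _
        _ ≤ _ := by gcongr; linarith
  calc _ ≤ 2 ^ k * ((n : ℝ) ^ k + 1) * q ^ n := by gcongr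
    _ = _ := by ring

theorem norm_coeff_flowField_le {F : ℂ⟦X⟧} {q M : ℝ} (hq0 : 0 ≤ q) (hq1 : q ≤ 1) (hM : 0 ≤ M)
    (h : ∀ n, ‖PowerSeries.coeff n F‖ ≤ M * q ^ n) (n : ℕ) :
    ‖PowerSeries.coeff n (flowField F)‖ ≤ 2 * M * ((n : ℝ) + 1) := by
  have h1 : ∀ n, ‖PowerSeries.coeff n F‖ ≤ M := fun n =>
    (h n).trans (mul_le_of_le_one_right hM (pow_le_one₀ hq0 hq1))
  rcases n with _ | n
  · rw [coeff_zero_flowField]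
    have := h1 1
    simp
    linarith
  · rw [coeff_succ_flowField]
    have e1 : ‖((n : ℂ) + 2)‖ = n + 2 := by
      rw [show (n : ℂ) + 2 = ((n + 2 : ℕ) : ℂ) by push_cast; rfl, Complex.norm_natCast]
      push_cast; rfl
    calc _ ≤ ‖((n : ℂ) + 2) * PowerSeries.coeff (n + 2) F‖ + ‖(n : ℂ) * PowerSeries.coeff n F‖ :=
          norm_sub_le _ _
      _ ≤ (n + 2) * M + n * M := by
          rw [norm_mul, norm_mul, e1, Complex.norm_natCast]
          gcongr
          · exact h1 _
          · exact h1 _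
      _ ≤ _ := by push_cast; nlinarith

/-- Summation by parts: the derivative of the energy only involves the defect of skew-adjointness of
the generator. -/
theorem hasSum_skew_defect_mul_inner {F : ℂ⟦X⟧} {w : ℕ → ℝ} {k : ℕ} {W q M : ℝ}
    (hw : ∀ n, 0 ≤ w n) (hW : 0 ≤ W) (hwW : ∀ n : ℕ, w n ≤ W * ((n : ℝ) + 1) ^ k)
    (hq0 : 0 ≤ q) (hq1 : q < 1) (hM : 0 ≤ M)
    (h : ∀ n, ‖PowerSeries.coeff n F‖ ≤ M * q ^ n) :
    HasSum (fun n : ℕ => (((n : ℝ) + 1) * w n - n * w (n + 1)) *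
        inner ℝ (PowerSeries.coeff n F) (PowerSeries.coeff (n + 1) F))
      (∑' n, w n * inner ℝ (PowerSeries.coeff n F) (PowerSeries.coeff n (flowField F))) := by
  set a : ℕ → ℂ := fun n => PowerSeries.coeff n F with ha
  have h1 : ∀ n, ‖a n‖ ≤ M := fun n =>
    (h n).trans (mul_le_of_le_one_right hM (pow_le_one₀ hq0 hq1.le))
  have hin : ∀ n, |inner ℝ (a n) (a (n + 1))| ≤ M * M * q ^ n := by
    intro n
    refine (abs_real_inner_le_norm _ _).trans ?_
    calc ‖a n‖ * ‖a (n + 1)‖ ≤ (M * q ^ n) * M :=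
          mul_le_mul (h n) (h1 _) (norm_nonneg _) (by positivity)
      _ = _ := by ring
  have hs1 : Summable (fun n : ℕ => ((n : ℝ) + 1) * w n * inner ℝ (a n) (a (n + 1))) := by
    refine Summable.of_norm_bounded
      ((summable_succ_pow_mul_geometric (k + 1) hq0 hq1).mul_left (W * (M * M))) fun n => ?_
    have := hw n
    rw [Real.norm_eq_abs, abs_mul, abs_of_nonneg (by positivity)]
    calc _ ≤ ((n : ℝ) + 1) * (W * ((n : ℝ) + 1) ^ k) * (M * M * q ^ n) :=
          mul_le_mul (mul_le_mul_of_nonneg_left (hwW n) (by positivity)) (hin n) (abs_nonneg _)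
            (by positivity)
      _ = _ := by ring
  have hs2 : Summable (fun n : ℕ => (n : ℝ) * w (n + 1) * inner ℝ (a n) (a (n + 1))) := by
    refine Summable.of_norm_bounded
      ((summable_succ_pow_mul_geometric (k + 1) hq0 hq1).mul_left (2 ^ k * W * (M * M)))
      fun n => ?_
    have := hw (n + 1)
    have h3 : w (n + 1) ≤ W * (2 * ((n : ℝ) + 1)) ^ k := by
      refine (hwW _).trans ?_
      gcongr
      push_cast
      have : (0 : ℝ) ≤ n := n.cast_nonneg
      linarith
    rw [Real.norm_eq_abs, abs_mul, abs_of_nonneg (by positivity)]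
    calc _ ≤ ((n : ℝ) + 1) * (W * (2 * ((n : ℝ) + 1)) ^ k) * (M * M * q ^ n) := by
          refine mul_le_mul (mul_le_mul ?_ h3 this (by positivity)) (hin n) (abs_nonneg _)
            (by positivity)
          linarith
      _ = _ := by rw [mul_pow]; ring
  -- the terms coming from `-z² d/dz`, shifted by one index
  have hs3 : HasSum (fun n : ℕ => if n = 0 then 0 else
      ((n - 1 : ℕ) : ℝ) * w n * inner ℝ (a (n - 1)) (a n))
      (∑' n : ℕ, (n : ℝ) * w (n + 1) * inner ℝ (a n) (a (n + 1))) := by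
    rw [← hasSum_nat_add_iff' 1]
    simpa using hs2.hasSum
  have key := hs1.hasSum.sub hs3
  have e : (fun n : ℕ => ((n : ℝ) + 1) * w n * inner ℝ (a n) (a (n + 1)) -
      (if n = 0 then 0 else ((n - 1 : ℕ) : ℝ) * w n * inner ℝ (a (n - 1)) (a n))) =
      fun n => w n * inner ℝ (a n) (PowerSeries.coeff n (flowField F)) := by
    funext n
    rcases n with _ | n
    · simp [coeff_zero_flowField, ha]
    · rw [coeff_succ_flowField, inner_sub_right]
      have e1 : ((n : ℂ) + 2) * PowerSeries.coeff (n + 2) F = ((n : ℝ) + 2) • a (n + 2) := by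
        rw [Complex.real_smul]; push_cast; rfl
      have e2 : (n : ℂ) * PowerSeries.coeff n F = (n : ℝ) • a n := by
        rw [Complex.real_smul]; push_cast; rfl
      rw [e1, e2, real_inner_smul_right, real_inner_smul_right, real_inner_comm (a n)]
      simp
      ring
  rw [e] at key
  rw [key.tsum_eq]
  simpa only [sub_mul] using hs1.hasSum.sub hs2.hasSum

theorem summable_weight_mul_norm_sq {w : ℕ → ℝ} {K : ℝ} (hw : IsFlowWeight w K)
    {F : ℝ → ℂ⟦X⟧} (hB : IsLocallyGeometric F) (t : ℝ) :
    Summable (fun n => w n * ‖PowerSeries.coeff n (F t)‖ ^ 2) := by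
  obtain ⟨q, M, hq0, hq1, hM, h⟩ := hB |t|
  obtain ⟨k, W, hW, hwW⟩ := hw.growth
  refine Summable.of_nonneg_of_le (fun n => mul_nonneg (hw.nonneg n) (by positivity)) (fun n => ?_)
    ((summable_succ_pow_mul_geometric k hq0 hq1).mul_left (W * M ^ 2))
  have h1 : ‖PowerSeries.coeff n (F t)‖ ^ 2 ≤ M ^ 2 * q ^ n := by
    calc _ ≤ (M * q ^ n) ^ 2 := by gcongr; exact h t le_rfl n
      _ = M ^ 2 * (q ^ n * q ^ n) := by ring
      _ ≤ M ^ 2 * q ^ n := by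
        gcongr
        exact mul_le_of_le_one_right (by positivity) (pow_le_one₀ hq0 hq1.le)
  calc _ ≤ (W * ((n : ℝ) + 1) ^ k) * (M ^ 2 * q ^ n) :=
        mul_le_mul (hwW n) h1 (by positivity) (by positivity)
    _ = _ := by ring

theorem hasDerivAt_energy {w : ℕ → ℝ} {K : ℝ} (hw : IsFlowWeight w K)
    {F : ℝ → ℂ⟦X⟧} (hF : IsFlowSolution F) (hB : IsLocallyGeometric F) (t : ℝ) :
    ∃ d : ℝ, |d| ≤ 2 * K * ∑' n, w n * ‖PowerSeries.coeff n (F t)‖ ^ 2 ∧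
      HasDerivAt (fun s => ∑' n, w n * ‖PowerSeries.coeff n (F s)‖ ^ 2) d t := by
  obtain ⟨q, M, hq0, hq1, hM, h⟩ := hB (|t| + 1)
  obtain ⟨k, W, hW, hwW⟩ := hw.growth
  have hd : HasDerivAt (fun s => ∑' n, w n * ‖PowerSeries.coeff n (F s)‖ ^ 2)
      (∑' n, w n * (2 * inner ℝ (PowerSeries.coeff n (F t))
        (PowerSeries.coeff n (flowField (F t))))) t := by
    refine hasDerivAt_tsum_of_isPreconnected
      (u := fun n : ℕ => 4 * W * M ^ 2 * (((n : ℝ) + 1) ^ (k + 1) * q ^ n))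
      (g := fun n s => w n * ‖PowerSeries.coeff n (F s)‖ ^ 2)
      (g' := fun n s => w n * (2 * inner ℝ (PowerSeries.coeff n (F s))
        (PowerSeries.coeff n (flowField (F s)))))
      ((summable_succ_pow_mul_geometric (k + 1) hq0 hq1).mul_left _)
      (isOpen_Ioo (a := -(|t| + 1)) (b := |t| + 1)) isPreconnected_Ioo
      (fun n s _ => ((hF s n).norm_sq).const_mul _) (fun n s hs => ?_)
      (y₀ := t) ?_ (summable_weight_mul_norm_sq hw hB t) ?_
    · have hs' : |s| ≤ |t| + 1 := abs_le.2 ⟨hs.1.le, hs.2.le⟩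
      rw [Real.norm_eq_abs, abs_mul, abs_mul, abs_of_nonneg (hw.nonneg n), abs_two]
      calc _ ≤ (W * ((n : ℝ) + 1) ^ k) * (2 * ((M * q ^ n) * (2 * M * ((n : ℝ) + 1)))) := by
            refine mul_le_mul (hwW n) ?_ (by positivity) (by positivity)
            gcongr
            refine (abs_real_inner_le_norm _ _).trans ?_
            exact mul_le_mul (h s hs' n) (norm_coeff_flowField_le hq0 hq1.le hM (h s hs') n)
              (norm_nonneg _) (by positivity)
        _ = _ := by ring
    · constructor <;> linarith [neg_abs_le t, le_abs_self t]
    · constructor <;> linarith [neg_abs_le t, le_abs_self t]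
  refine ⟨_, ?_, hd⟩
  have ht : |t| ≤ |t| + 1 := by linarith
  have hs := hasSum_skew_defect_mul_inner hw.nonneg hW hwW hq0 hq1 hM (h t ht)
  have hE := summable_weight_mul_norm_sq hw hB t
  set a : ℕ → ℂ := fun n => PowerSeries.coeff n (F t) with ha
  have e : ∀ n, w n * (2 * inner ℝ (PowerSeries.coeff n (F t))
      (PowerSeries.coeff n (flowField (F t)))) = 2 * (w n * inner ℝ (PowerSeries.coeff n (F t))
      (PowerSeries.coeff n (flowField (F t)))) := fun n => by ring
  simp_rw [e]
  rw [tsum_mul_left, ← hs.tsum_eq, ← tsum_mul_left]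
  have hE' : Summable (fun n => w (n + 1) * ‖a (n + 1)‖ ^ 2) := (summable_nat_add_iff 1).2 hE
  have hbound : ∀ n : ℕ, ‖2 * ((((n : ℝ) + 1) * w n - n * w (n + 1)) * inner ℝ (a n) (a (n + 1)))‖
      ≤ K * (w n * ‖a n‖ ^ 2 + w (n + 1) * ‖a (n + 1)‖ ^ 2) := by
    intro n
    have h0 := hw.nonneg n
    have h1 := hw.nonneg (n + 1)
    have hK := hw.const_nonneg
    refine abs_le_of_sq_le_sq ?_ (by positivity)
    have hin : inner ℝ (a n) (a (n + 1)) ^ 2 ≤ ‖a n‖ ^ 2 * ‖a (n + 1)‖ ^ 2 := by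
      rw [← mul_pow, sq_le_sq, abs_of_nonneg (by positivity : 0 ≤ ‖a n‖ * ‖a (n + 1)‖)]
      exact abs_real_inner_le_norm _ _
    calc _ = 4 * ((((n : ℝ) + 1) * w n - n * w (n + 1)) ^ 2 * inner ℝ (a n) (a (n + 1)) ^ 2) := by
          ring
      _ ≤ 4 * (K ^ 2 * (w n * w (n + 1)) * (‖a n‖ ^ 2 * ‖a (n + 1)‖ ^ 2)) := by
          gcongr
          exact hw.skew n
      _ ≤ _ := by
          have := sq_nonneg (w n * ‖a n‖ ^ 2 - w (n + 1) * ‖a (n + 1)‖ ^ 2)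
          nlinarith [mul_nonneg (sq_nonneg K) this]
  have hS := (hE.add hE').mul_left K
  refine (tsum_of_norm_bounded hS.hasSum hbound).trans ?_
  rw [tsum_mul_left, hE.tsum_add hE', mul_comm 2 K, mul_assoc]
  gcongr
  · exact hw.const_nonneg
  · have := hE.tsum_eq_zero_add
    have h0 : 0 ≤ w 0 * ‖a 0‖ ^ 2 := mul_nonneg (hw.nonneg 0) (by positivity)
    linarith

/-- Grönwall's inequality for the energy `∑ wₙ |aₙ|²` along the flow. -/
theorem energy_le_exp_mul {w : ℕ → ℝ} {K : ℝ} (hw : IsFlowWeight w K)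
    {F : ℝ → ℂ⟦X⟧} (hF : IsFlowSolution F) (hB : IsLocallyGeometric F) (t : ℝ) :
    ∑' n, w n * ‖PowerSeries.coeff n (F t)‖ ^ 2 ≤
      Real.exp (2 * K * |t|) * ∑' n, w n * ‖PowerSeries.coeff n (F 0)‖ ^ 2 := by
  set G : ℝ → ℝ := fun s => ∑' n, w n * ‖PowerSeries.coeff n (F s)‖ ^ 2 with hG
  choose d hd hGd using hasDerivAt_energy hw hF hB
  have hprod : ∀ c s : ℝ, HasDerivAt (fun s => Real.exp (c * s) * G s)
      (Real.exp (c * s) * (c * G s + d s)) s := by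
    intro c s
    have h1 : HasDerivAt (fun s => Real.exp (c * s)) (Real.exp (c * s) * (c * 1)) s :=
      ((hasDerivAt_id s).const_mul c).exp
    exact (h1.mul (hGd s)).congr_deriv (by ring)
  change G t ≤ Real.exp (2 * K * |t|) * G 0
  rcases le_total 0 t with hs | hs
  · have hanti : Antitone (fun s => Real.exp (-(2 * K) * s) * G s) := by
      refine antitone_of_deriv_nonpos (fun s => (hprod _ s).differentiableAt) fun s => ?_
      rw [(hprod _ s).deriv]
      refine mul_nonpos_of_nonneg_of_nonpos (Real.exp_pos _).le ?_
      linarith [(abs_le.1 (hd s)).2]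
    have h1 := hanti hs
    simp only [mul_zero, Real.exp_zero, one_mul] at h1
    rw [neg_mul, Real.exp_neg, inv_mul_le_iff₀ (Real.exp_pos _)] at h1
    rwa [abs_of_nonneg hs]
  · have hm : Monotone (fun s => Real.exp (2 * K * s) * G s) := by
      refine monotone_of_deriv_nonneg (fun s => (hprod _ s).differentiableAt) fun s => ?_
      rw [(hprod _ s).deriv]
      refine mul_nonneg (Real.exp_pos _).le ?_
      linarith [(abs_le.1 (hd s)).1]
    have h1 := hm hs
    simp only [mul_zero, Real.exp_zero, one_mul] at h1
    rw [abs_of_nonpos hs, mul_neg, Real.exp_neg, ← div_eq_inv_mul, le_div_iff₀' (Real.exp_pos _)]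
    exact h1

/-! ### The hyperbolic flow on the disc and its Taylor series -/

theorem Real.hasDerivAt_tanh_one_sub_sq (t : ℝ) :
    HasDerivAt Real.tanh (1 - Real.tanh t ^ 2) t := by
  have h := (Real.hasDerivAt_sinh t).div (Real.hasDerivAt_cosh t) (Real.cosh_pos t).ne'
  have e : Real.tanh = Real.sinh / Real.cosh := by
    funext s; rw [Real.tanh_eq_sinh_div_cosh]; rfl
  rw [e]
  have := (Real.cosh_pos t).ne'
  refine h.congr_deriv ?_
  simp only [Pi.div_apply]
  field_simp

theorem Real.one_sub_tanh_sq (t : ℝ) : 1 - Real.tanh t ^ 2 = (Real.cosh t ^ 2)⁻¹ := by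
  have := (Real.cosh_pos t).ne'
  rw [Real.tanh_eq_sinh_div_cosh]
  field_simp
  linarith [Real.cosh_sq t]

theorem one_add_tanh_mul_ne_zero (t : ℝ) (z : 𝔻) : (1 : ℂ) + Real.tanh t * (z : ℂ) ≠ 0 := by
  intro h
  have h1 : ‖(Real.tanh t : ℂ) * (z : ℂ)‖ = 1 := by
    rw [← neg_eq_of_add_eq_zero_right h, norm_neg, norm_one]
  have h2 : ‖(Real.tanh t : ℂ) * (z : ℂ)‖ < 1 := by
    rw [norm_mul, Complex.norm_real, Real.norm_eq_abs]
    calc _ ≤ 1 * ‖(z : ℂ)‖ := by gcongr; exact (Real.abs_tanh_lt_one t).le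
      _ < 1 := by rw [one_mul]; exact z.norm_lt_one
  exact h2.ne h1

/-- The one-parameter group `z ↦ (z + tanh t) / (1 + tanh t · z)` of hyperbolic automorphisms of the
disc fixing `1` and `-1`. -/
noncomputable def discFlow (t : ℝ) (z : 𝔻) : 𝔻 :=
  .mk (((z : ℂ) + Real.tanh t) / (1 + Real.tanh t * z)) (by
    have hz := z.normSq_lt_one
    have hr := Real.tanh_sq_lt_one t
    have hlt : Complex.normSq ((z : ℂ) + Real.tanh t) <
        Complex.normSq (1 + Real.tanh t * (z : ℂ)) := by
      simp only [Complex.normSq_apply, Complex.add_re, Complex.add_im, Complex.mul_re,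
        Complex.mul_im, Complex.ofReal_re, Complex.ofReal_im, Complex.one_re,
        Complex.one_im] at hz ⊢
      nlinarith [mul_pos (sub_pos.2 hz) (sub_pos.2 hr)]
    have hpos := (Complex.normSq_nonneg ((z : ℂ) + Real.tanh t)).trans_lt hlt
    rw [← sq_lt_one_iff₀ (norm_nonneg _), ← Complex.normSq_eq_norm_sq, Complex.normSq_div,
      div_lt_one hpos]
    exact hlt)

theorem coe_discFlow (t : ℝ) (z : 𝔻) :
    (discFlow t z : ℂ) = ((z : ℂ) + Real.tanh t) / (1 + Real.tanh t * z) := rfl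

theorem discFlow_add (s t : ℝ) (z : 𝔻) : discFlow (s + t) z = discFlow s (discFlow t z) := by
  apply Complex.UnitDisc.coe_injective
  have h1 := one_add_tanh_mul_ne_zero t z
  have h2 := one_add_tanh_mul_ne_zero s (discFlow t z)
  have h3 := one_add_tanh_mul_ne_zero (s + t) z
  rw [coe_discFlow] at h2
  rw [coe_discFlow, coe_discFlow, coe_discFlow]
  have hs : (Complex.cosh s) ≠ 0 := by exact_mod_cast (Real.cosh_pos s).ne'
  have ht : (Complex.cosh t) ≠ 0 := by exact_mod_cast (Real.cosh_pos t).ne'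
  have hst : (Complex.cosh (s + t)) ≠ 0 := by exact_mod_cast (Real.cosh_pos (s + t)).ne'
  rw [div_eq_div_iff h3 h2]
  push_cast [Real.tanh_eq_sinh_div_cosh] at h1 ⊢
  rw [Complex.cosh_add] at hst
  have h4 : Complex.cosh t + Complex.sinh t * z ≠ 0 := by
    intro h
    apply h1
    rw [div_mul_eq_mul_div, one_add_div ht, h, zero_div]
  rw [Complex.sinh_add, Complex.cosh_add]
  clear h1 h2 h3
  generalize Complex.sinh s = a at *
  generalize Complex.sinh t = b at *
  generalize Complex.cosh s = c at *
  generalize Complex.cosh t = d at *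
  have h5 : z + b / d = (d * z + b) / d := by field_simp
  have h6 : 1 + b / d * z = (d + b * z) / d := by field_simp
  rw [h5, h6, div_div_div_cancel_right₀ ht]
  generalize (z : ℂ) = ζ at *
  have h7 : d * c + b * a ≠ 0 := by rwa [mul_comm d, mul_comm b]
  have h8 : d + ζ * b ≠ 0 := by rwa [mul_comm ζ]
  rw [eq_comm]
  field_simp
  ring

theorem discFlow_zero (z : 𝔻) : discFlow 0 z = z := by
  apply Complex.UnitDisc.coe_injective
  simp [coe_discFlow]

theorem hyperbolicAut_eq_discFlow {r : ℝ} (h0 : 0 < r) (h1 : r < 1) :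
    hyperbolicAut r h0 h1 = discFlow (Real.artanh r) := by
  funext z
  apply Complex.UnitDisc.coe_injective
  rw [coe_discFlow, Real.tanh_artanh ⟨by linarith, h1⟩]
  rfl

/-- The Taylor series of `discFlow t` at the origin. -/
noncomputable def mobiusSeries (t : ℝ) : ℂ⟦X⟧ :=
  PowerSeries.mk fun n => match n with
    | 0 => (Real.tanh t : ℂ)
    | m + 1 => (1 - (Real.tanh t : ℂ) ^ 2) * (-(Real.tanh t : ℂ)) ^ m

theorem coeff_zero_mobiusSeries (t : ℝ) :
    PowerSeries.coeff 0 (mobiusSeries t) = (Real.tanh t : ℂ) := by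
  rw [mobiusSeries, PowerSeries.coeff_mk]

theorem coeff_succ_mobiusSeries (t : ℝ) (m : ℕ) : PowerSeries.coeff (m + 1) (mobiusSeries t) =
    (1 - (Real.tanh t : ℂ) ^ 2) * (-(Real.tanh t : ℂ)) ^ m := by
  rw [mobiusSeries, PowerSeries.coeff_mk]

theorem mobiusSeries_zero : mobiusSeries 0 = PowerSeries.X := by
  ext n
  rcases n with _ | _ | n
  · simp [coeff_zero_mobiusSeries]
  · simp [coeff_succ_mobiusSeries]
  · simp [coeff_succ_mobiusSeries, PowerSeries.coeff_X]

theorem isFlowSolution_mobiusSeries : IsFlowSolution mobiusSeries := by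
  intro t n
  have h0 : HasDerivAt (fun s => (Real.tanh s : ℂ)) (1 - (Real.tanh t : ℂ) ^ 2) t := by
    simpa using (Real.hasDerivAt_tanh_one_sub_sq t).ofReal_comp
  rcases n with _ | n
  · simp only [coeff_zero_mobiusSeries, coeff_zero_flowField, coeff_succ_mobiusSeries _ 0, pow_zero,
      mul_one]
    exact h0
  · simp only [coeff_succ_flowField, coeff_succ_mobiusSeries]
    have h1 := ((h0.pow 2).const_sub 1).mul (h0.neg.pow n)
    rcases n with _ | n
    · refine h1.congr_deriv ?_
      simp
      ring
    · rw [coeff_succ_mobiusSeries]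
      refine h1.congr_deriv ?_
      simp
      ring

theorem isLocallyGeometric_mobiusSeries : IsLocallyGeometric mobiusSeries := by
  intro T
  obtain ⟨q, hq0, hq1, hq⟩ : ∃ q : ℝ, 0 < q ∧ q < 1 ∧ ∀ t, |t| ≤ T → |Real.tanh t| ≤ q := by
    have hc : Continuous fun t => |Real.tanh t| :=
      (continuous_iff_continuousAt.2 fun t =>
        (Real.hasDerivAt_tanh_one_sub_sq t).continuousAt).abs
    obtain ⟨t₀, -, ht₀⟩ := (isCompact_Icc (a := -|T|) (b := |T|)).exists_isMaxOn
      ⟨0, by simp⟩ hc.continuousOn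
    refine ⟨max |Real.tanh t₀| (1 / 2), by positivity,
      max_lt (Real.abs_tanh_lt_one _) (by norm_num), fun t ht => le_max_of_le_left ?_⟩
    exact ht₀ (abs_le.1 (ht.trans (le_abs_self T)))
  -- the factor `q⁻¹` absorbs the shift of exponents in the coefficient of `z ^ (n + 1)`
  refine ⟨q, q⁻¹, hq0.le, hq1, by positivity, fun t ht n => ?_⟩
  have hqi : 1 ≤ q⁻¹ := (one_le_inv₀ hq0).2 hq1.le
  rcases n with _ | n
  · rw [coeff_zero_mobiusSeries, Complex.norm_real, Real.norm_eq_abs, pow_zero, mul_one]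
    exact (hq t ht).trans (hq1.le.trans hqi)
  · rw [coeff_succ_mobiusSeries, norm_mul, norm_pow, norm_neg, Complex.norm_real, Real.norm_eq_abs,
      pow_succ' q, inv_mul_cancel_left₀ hq0.ne']
    have h1 : ‖1 - (Real.tanh t : ℂ) ^ 2‖ ≤ 1 := by
      rw [show 1 - (Real.tanh t : ℂ) ^ 2 = ((1 - Real.tanh t ^ 2 : ℝ) : ℂ) by push_cast; rfl,
        Complex.norm_real, Real.norm_of_nonneg (by linarith [Real.tanh_sq_lt_one t])]
      linarith [sq_nonneg (Real.tanh t)]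
    calc _ ≤ 1 * q ^ n := by gcongr; exact hq t ht
      _ = _ := one_mul _

theorem hasSum_mobiusSeries (t : ℝ) (z : 𝔻) :
    HasSum (fun n => PowerSeries.coeff n (mobiusSeries t) * (z : ℂ) ^ n) (discFlow t z) := by
  have hne := one_add_tanh_mul_ne_zero t z
  have hlt : ‖-(Real.tanh t : ℂ) * (z : ℂ)‖ < 1 := by
    rw [norm_mul, norm_neg, Complex.norm_real, Real.norm_eq_abs]
    calc _ ≤ 1 * ‖(z : ℂ)‖ := by gcongr; exact (Real.abs_tanh_lt_one t).le
      _ < 1 := by rw [one_mul]; exact z.norm_lt_one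
  have h := (hasSum_geometric_of_norm_lt_one hlt).mul_left
    ((1 - (Real.tanh t : ℂ) ^ 2) * (z : ℂ))
  rw [← hasSum_nat_add_iff' 1]
  have e1 : (fun n => PowerSeries.coeff (n + 1) (mobiusSeries t) * (z : ℂ) ^ (n + 1)) = fun n =>
      (1 - (Real.tanh t : ℂ) ^ 2) * (z : ℂ) * (-(Real.tanh t : ℂ) * (z : ℂ)) ^ n := by
    funext n
    rw [coeff_succ_mobiusSeries, mul_pow]
    ring
  have e2 : (discFlow t z : ℂ) -
      ∑ i ∈ Finset.range 1, PowerSeries.coeff i (mobiusSeries t) * (z : ℂ) ^ i =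
      (1 - (Real.tanh t : ℂ) ^ 2) * (z : ℂ) * (1 - -(Real.tanh t : ℂ) * (z : ℂ))⁻¹ := by
    rw [coe_discFlow, neg_mul, sub_neg_eq_add]
    simp only [Finset.range_one, Finset.sum_singleton, coeff_zero_mobiusSeries]
    clear e1 h hlt
    generalize (Real.tanh t : ℂ) = τ at *
    generalize (z : ℂ) = ζ at *
    have hne' : 1 + ζ * τ ≠ 0 := by rwa [mul_comm]
    field_simp
    ring
  rw [e1, e2]
  exact h

/-- The Taylor series of `p ∘ discFlow t` for a polynomial `p`. -/
noncomputable def polyFlow (p : Polynomial ℂ) (t : ℝ) : ℂ⟦X⟧ :=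
  Polynomial.aeval (mobiusSeries t) p

theorem polyFlow_zero (p : Polynomial ℂ) (n : ℕ) :
    PowerSeries.coeff n (polyFlow p 0) = p.coeff n := by
  have e : (p : ℂ⟦X⟧) = Polynomial.aeval PowerSeries.X p := by
    induction p using Polynomial.induction_on' with
    | add p q hp hq => simp [hp, hq]
    | monomial n c => simp [PowerSeries.monomial_eq_C_mul_X_pow]
  rw [polyFlow, mobiusSeries_zero, ← e]
  exact Polynomial.coeff_coe p n

/-- Properties of families of power series that are closed under sums and products pass from
`mobiusSeries` to `polyFlow p`. -/
theorem polyFlow_induction {P : (ℝ → ℂ⟦X⟧) → Prop} (hC : ∀ c, P fun _ => PowerSeries.C c)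
    (hadd : ∀ F G, P F → P G → P fun t => F t + G t)
    (hmul : ∀ F G, P F → P G → P fun t => F t * G t) (hm : P mobiusSeries)
    (p : Polynomial ℂ) : P (polyFlow p) := by
  have e : ∀ c, polyFlow (Polynomial.C c) = fun _ => PowerSeries.C c := fun c => by
    funext t; simp [polyFlow]
  induction p using Polynomial.induction_on with
  | C c => rw [e]; exact hC c
  | add p q hp hq =>
    have : polyFlow (p + q) = fun t => polyFlow p t + polyFlow q t := by
      funext t; simp [polyFlow]
    rw [this]; exact hadd _ _ hp hq
  | monomial n c h =>
    have : polyFlow (Polynomial.C c * Polynomial.X ^ (n + 1)) =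
        fun t => polyFlow (Polynomial.C c * Polynomial.X ^ n) t * mobiusSeries t := by
      funext t; simp [polyFlow, pow_succ, mul_assoc]
    rw [this]; exact hmul _ _ h hm

theorem isFlowSolution_polyFlow (p : Polynomial ℂ) : IsFlowSolution (polyFlow p) :=
  polyFlow_induction isFlowSolution_C (fun _ _ => .add) (fun _ _ => .mul)
    isFlowSolution_mobiusSeries p

theorem isLocallyGeometric_polyFlow (p : Polynomial ℂ) : IsLocallyGeometric (polyFlow p) :=
  polyFlow_induction isLocallyGeometric_C (fun _ _ => .add) (fun _ _ => .mul)
    isLocallyGeometric_mobiusSeries p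

theorem hasSum_coeff_mul_mul_pow {F G : ℂ⟦X⟧} {z a b : ℂ}
    (hF : HasSum (fun n => PowerSeries.coeff n F * z ^ n) a)
    (hG : HasSum (fun n => PowerSeries.coeff n G * z ^ n) b) :
    HasSum (fun n => PowerSeries.coeff n (F * G) * z ^ n) (a * b) := by
  have e : (fun n => PowerSeries.coeff n (F * G) * z ^ n) = fun n =>
      ∑ kl ∈ Finset.HasAntidiagonal.antidiagonal n,
        (PowerSeries.coeff kl.1 F * z ^ kl.1) * (PowerSeries.coeff kl.2 G * z ^ kl.2) := by
    funext n
    rw [PowerSeries.coeff_mul, Finset.sum_mul]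
    refine Finset.sum_congr rfl fun p hp => ?_
    rw [← Finset.HasAntidiagonal.mem_antidiagonal.1 hp, pow_add]
    ring
  rw [e, ← hF.tsum_eq, ← hG.tsum_eq,
    tsum_mul_tsum_eq_tsum_sum_antidiagonal_of_summable_norm hF.summable.norm hG.summable.norm]
  exact (summable_norm_sum_mul_antidiagonal_of_summable_norm hF.summable.norm
    hG.summable.norm).of_norm.hasSum

theorem hasSum_polyFlow (p : Polynomial ℂ) (t : ℝ) (z : 𝔻) :
    HasSum (fun n => PowerSeries.coeff n (polyFlow p t) * (z : ℂ) ^ n)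
      (p.eval (discFlow t z : ℂ)) := by
  have hC : ∀ c, HasSum (fun n => PowerSeries.coeff n (PowerSeries.C c) * (z : ℂ) ^ n) c := by
    intro c
    convert hasSum_single (f := fun n => PowerSeries.coeff n (PowerSeries.C c) * (z : ℂ) ^ n) 0 ?_
    · simp
    · intro n hn
      simp [PowerSeries.coeff_C, hn]
  induction p using Polynomial.induction_on with
  | C c =>
    have : polyFlow (Polynomial.C c) t = PowerSeries.C c := by simp [polyFlow]
    rw [this, Polynomial.eval_C]
    exact hC c
  | add p q hp hq =>
    have : polyFlow (p + q) t = polyFlow p t + polyFlow q t := by simp [polyFlow]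
    simp only [this, map_add, add_mul, Polynomial.eval_add]
    exact hp.add hq
  | monomial n c h =>
    have : polyFlow (Polynomial.C c * Polynomial.X ^ (n + 1)) t =
        polyFlow (Polynomial.C c * Polynomial.X ^ n) t * mobiusSeries t := by
      simp [polyFlow, pow_succ, mul_assoc]
    rw [this, pow_succ, ← mul_assoc, Polynomial.eval_mul_X]
    exact hasSum_coeff_mul_mul_pow h (hasSum_mobiusSeries t z)

open scoped PowerSeries.WithPiTopology in
/-- As `discFlow t` tends to a constant, so do the Taylor coefficients of `p ∘ discFlow t`. -/
theorem tendsto_coeff_polyFlow {l : Filter ℝ} {σ : ℝ} (hσ : σ ^ 2 = 1)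
    (hl : Tendsto Real.tanh l (𝓝 σ)) (p : Polynomial ℂ) (n : ℕ) :
    Tendsto (fun t => PowerSeries.coeff (n + 1) (polyFlow p t)) l (𝓝 0) := by
  have hl' : Tendsto (fun t => (Real.tanh t : ℂ)) l (𝓝 σ) :=
    (Complex.continuous_ofReal.tendsto σ).comp hl
  have hm : Tendsto mobiusSeries l (𝓝 (PowerSeries.C (σ : ℂ))) := by
    rw [PowerSeries.WithPiTopology.tendsto_iff_coeff_tendsto]
    rintro (_ | m)
    · simpa [coeff_zero_mobiusSeries] using hl'
    · simp only [coeff_succ_mobiusSeries]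
      have h := ((hl'.pow 2).const_sub 1).mul (hl'.neg.pow m)
      have h1 : (1 : ℂ) - (σ : ℂ) ^ 2 = 0 := by
        rw [← Complex.ofReal_pow, hσ]; simp
      simpa [h1, PowerSeries.coeff_C] using h
  have h := (p.continuous_aeval.tendsto (PowerSeries.C (σ : ℂ))).comp hm
  have h2 := (PowerSeries.WithPiTopology.tendsto_iff_coeff_tendsto _ _ _ _).1 h (n + 1)
  have e : Polynomial.aeval (PowerSeries.C (σ : ℂ)) p = PowerSeries.C (p.eval (σ : ℂ)) := by
    rw [Polynomial.aeval_def, Polynomial.eval, Polynomial.hom_eval₂]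
    simp
  rw [e] at h2
  simpa [PowerSeries.coeff_C, polyFlow] using h2

theorem Real.tendsto_tanh_atTop : Tendsto Real.tanh atTop (𝓝 1) := by
  have e : ∀ t, Real.tanh t = (1 - Real.exp (-t) ^ 2) / (1 + Real.exp (-t) ^ 2) := by
    intro t
    have h : Real.exp t * Real.exp (-t) = 1 := by rw [← Real.exp_add]; simp
    have h1 := Real.exp_pos t
    have h2 := Real.exp_pos (-t)
    rw [Real.tanh_eq, div_eq_div_iff (by positivity) (by positivity)]
    linear_combination (2 * Real.exp (-t)) * h
  have h := Real.tendsto_exp_neg_atTop_nhds_zero.pow 2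
  have h2 := (h.const_sub 1).div (h.const_add 1) (by norm_num)
  rw [funext e]
  simpa [Pi.div_def] using h2

theorem Real.tendsto_tanh_atBot : Tendsto Real.tanh atBot (𝓝 (-1)) := by
  have h := (Real.tendsto_tanh_atTop.comp tendsto_neg_atBot_atTop).neg
  simpa [Function.comp_def] using h

/-! ### Examples of flow weights -/

/-- The weights of the norm of `D_β`. -/
theorem exists_isFlowWeight_rpow {β : ℝ} (hβ : 1 / 2 ≤ β) :
    ∃ K, IsFlowWeight (fun n : ℕ => ((n : ℝ) + 1) ^ (2 * β)) K := by
  have hp : 1 ≤ 2 * β := by linarith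
  generalize 2 * β = p at hp
  obtain ⟨k, hk⟩ := exists_nat_ge p
  have hpk : 0 ≤ (1 + p) ^ 2 * (2 : ℝ) ^ p := by positivity
  refine ⟨√((1 + p) ^ 2 * 2 ^ p), fun n => by positivity, Real.sqrt_nonneg _, fun n => ?_,
    k, 1, zero_le_one, fun n => ?_⟩
  · rw [Real.sq_sqrt hpk]
    have hn : (0 : ℝ) ≤ n := n.cast_nonneg
    push_cast
    rw [show (n : ℝ) + 1 + 1 = n + 2 by ring]
    set u : ℝ := ((n : ℝ) + 1) ^ p with hu
    set v : ℝ := ((n : ℝ) + 2) ^ p with hv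
    have hu0 : 0 < u := by positivity
    have hv0 : 0 < v := by positivity
    have huv : u ≤ v := Real.rpow_le_rpow (by positivity) (by linarith) (by linarith)
    have hvu : v ≤ 2 ^ p * u := by
      rw [hu, hv, ← Real.mul_rpow two_pos.le (by positivity)]
      exact Real.rpow_le_rpow (by positivity) (by linarith) (by linarith)
    -- Bernoulli's inequality for `(n + 1) / (n + 2) = 1 - 1 / (n + 2)`
    have hB : ((n : ℝ) + 2) * v - p * v ≤ (n + 2) * u := by
      have h := one_add_mul_self_le_rpow_one_add (s := -1 / ((n : ℝ) + 2))
        (by rw [le_div_iff₀ (by positivity)]; linarith) hp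
      have e : 1 + -1 / ((n : ℝ) + 2) = (n + 1) / (n + 2) := by field_simp; ring
      rw [e, Real.div_rpow (by positivity) (by positivity), ← hu, ← hv, le_div_iff₀ hv0] at h
      calc _ = ((n : ℝ) + 2) * ((1 + p * (-1 / (n + 2))) * v) := by field_simp; ring
        _ ≤ _ := by gcongr
    have h1 : |((n : ℝ) + 1) * u - n * v| ≤ (1 + p) * v := by
      rw [abs_le]
      constructor <;> nlinarith
    calc _ = |((n : ℝ) + 1) * u - n * v| ^ 2 := (sq_abs _).symm
      _ ≤ ((1 + p) * v) ^ 2 := by gcongr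
      _ = (1 + p) ^ 2 * (v * v) := by ring
      _ ≤ (1 + p) ^ 2 * (v * (2 ^ p * u)) := by gcongr
      _ = _ := by ring
  · rw [one_mul, ← Real.rpow_natCast]
    exact Real.rpow_le_rpow_of_exponent_le (by linarith [(n.cast_nonneg : (0 : ℝ) ≤ n)]) hk

/-- For the Dirichlet seminorm the generator is exactly skew-adjoint. -/
theorem isFlowWeight_natCast : IsFlowWeight (fun n : ℕ => (n : ℝ)) 0 where
  nonneg n := n.cast_nonneg
  const_nonneg := le_rfl
  skew n := by push_cast; ring_nf; rfl
  growth := ⟨1, 1, zero_le_one, fun n => by simp⟩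

/-- Adding a small multiple of `|a₀|²` to the Dirichlet seminorm costs little skew-adjointness. -/
theorem isFlowWeight_dirichlet_add {ε : ℝ} (h0 : 0 ≤ ε) (h1 : ε ≤ 1) :
    IsFlowWeight (fun n : ℕ => if n = 0 then ε ^ 2 else (n : ℝ)) ε where
  nonneg n := by split_ifs <;> positivity
  const_nonneg := h0
  skew n := by
    rcases n with _ | n
    · simp; ring_nf; rfl
    · simp
      calc _ = (0 : ℝ) := by ring
        _ ≤ _ := by positivity
  growth := ⟨1, 1, zero_le_one, fun n => by
    rcases n with _ | n
    · simpa using abs_le.2 ⟨by linarith, h1⟩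
    · simp⟩

namespace WeightedDirichlet

variable {β : ℝ}

/-! ### Coefficients and polynomials in `D_β` -/

/-- The `n`-th Taylor coefficient as a linear functional. -/
noncomputable def coeffLM (n : ℕ) : WeightedDirichlet β →ₗ[ℂ] ℂ where
  toFun f := f.coeff n
  map_add' f g := by rw [coeff_add]; rfl
  map_smul' c f := by rw [coeff_smul]; rfl

theorem coeffLM_apply (n : ℕ) (f : WeightedDirichlet β) : coeffLM n f = f.coeff n := rfl

theorem coeff_sub (f g : WeightedDirichlet β) (n : ℕ) :
    (f - g).coeff n = f.coeff n - g.coeff n := map_sub (coeffLM n) f g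

theorem coeff_zero (n : ℕ) : (0 : WeightedDirichlet β).coeff n = 0 := map_zero (coeffLM n)

@[simp] theorem sub_apply (f g : WeightedDirichlet β) (z : 𝔻) : (f - g) z = f z - g z := rfl

theorem ext_coeff {f g : WeightedDirichlet β} (h : ∀ n, f.coeff n = g.coeff n) : f = g := by
  ext z
  exact (f.hasSum_coeff z).unique (by simpa only [h] using g.hasSum_coeff z)

theorem norm_coeff_sq_mul_le (f : WeightedDirichlet β) (n : ℕ) :
    ‖f.coeff n‖ ^ 2 * ((n : ℝ) + 1) ^ (2 * β) ≤ ‖f‖ ^ 2 := by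
  rw [norm_sq_eq]
  exact f.summable_coeff.le_tsum n fun m _ => by positivity

theorem norm_coeff_le (hβ : 0 ≤ β) (f : WeightedDirichlet β) (n : ℕ) : ‖f.coeff n‖ ≤ ‖f‖ := by
  have h1 : (1 : ℝ) ≤ ((n : ℝ) + 1) ^ (2 * β) :=
    Real.one_le_rpow (by linarith [(n.cast_nonneg : (0 : ℝ) ≤ n)]) (by linarith)
  refine abs_le_of_sq_le_sq' ?_ (norm_nonneg _) |>.2
  refine le_trans ?_ (f.norm_coeff_sq_mul_le n)
  exact le_mul_of_one_le_right (by positivity) h1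

theorem norm_apply_le (hβ : 0 ≤ β) (f : WeightedDirichlet β) (z : 𝔻) :
    ‖f z‖ ≤ ‖f‖ * (1 - ‖(z : ℂ)‖)⁻¹ := by
  have hg := (hasSum_geometric_of_lt_one (norm_nonneg (z : ℂ)) z.norm_lt_one).mul_left ‖f‖
  rw [← (f.hasSum_coeff z).tsum_eq]
  refine tsum_of_norm_bounded hg fun n => ?_
  rw [norm_mul, norm_pow]
  gcongr
  exact f.norm_coeff_le hβ n

theorem tendsto_coeff (hβ : 0 ≤ β) {ι : Type*} {l : Filter ι} {u : ι → WeightedDirichlet β}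
    {f : WeightedDirichlet β} (h : Tendsto u l (𝓝 f)) (n : ℕ) :
    Tendsto (fun i => (u i).coeff n) l (𝓝 (f.coeff n)) := by
  rw [tendsto_iff_norm_sub_tendsto_zero] at h ⊢
  refine squeeze_zero (fun _ => norm_nonneg _) (fun i => ?_) h
  rw [← coeff_sub]
  exact norm_coeff_le hβ _ n

theorem tendsto_apply (hβ : 0 ≤ β) {ι : Type*} {l : Filter ι} {u : ι → WeightedDirichlet β}
    {f : WeightedDirichlet β} (h : Tendsto u l (𝓝 f)) (z : 𝔻) :
    Tendsto (fun i => u i z) l (𝓝 (f z)) := by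
  rw [tendsto_iff_norm_sub_tendsto_zero] at h ⊢
  refine squeeze_zero (fun _ => norm_nonneg _) (fun i => ?_)
    (by simpa using h.mul_const (1 - ‖(z : ℂ)‖)⁻¹)
  rw [← sub_apply]
  exact norm_apply_le hβ _ z

theorem exists_coeff_eq_polynomial (p : Polynomial ℂ) :
    ∃ f : WeightedDirichlet β, f.coeff = p.coeff :=
  exists_coeff_eq p.coeff <| summable_of_ne_finset_zero (s := p.support) fun n hn => by
    simp [Polynomial.notMem_support_iff.1 hn]

/-- A polynomial as an element of `D_β`. -/
noncomputable def ofPolynomial (p : Polynomial ℂ) : WeightedDirichlet β :=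
  (exists_coeff_eq_polynomial p).choose

@[simp] theorem coeff_ofPolynomial (p : Polynomial ℂ) (n : ℕ) :
    (ofPolynomial p : WeightedDirichlet β).coeff n = p.coeff n :=
  congrFun (exists_coeff_eq_polynomial p).choose_spec n

theorem ofPolynomial_apply (p : Polynomial ℂ) (z : 𝔻) :
    (ofPolynomial p : WeightedDirichlet β) z = p.eval (z : ℂ) := by
  have h := (ofPolynomial p : WeightedDirichlet β).hasSum_coeff z
  simp only [coeff_ofPolynomial] at h
  refine h.unique ?_
  rw [Polynomial.eval_eq_sum, Polynomial.sum]
  exact hasSum_sum_of_ne_finset_zero fun n hn => by simp [Polynomial.notMem_support_iff.1 hn]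

/-- The Taylor polynomial of degree less than `N`. -/
noncomputable def taylorPolynomial (f : WeightedDirichlet β) (N : ℕ) : Polynomial ℂ :=
  PowerSeries.trunc N (PowerSeries.mk f.coeff)

theorem coeff_taylorPolynomial (f : WeightedDirichlet β) (N n : ℕ) :
    (f.taylorPolynomial N).coeff n = if n < N then f.coeff n else 0 := by
  rw [taylorPolynomial, PowerSeries.coeff_trunc, PowerSeries.coeff_mk]

theorem tendsto_ofPolynomial_taylorPolynomial (f : WeightedDirichlet β) :
    Tendsto (fun N => (ofPolynomial (f.taylorPolynomial N) : WeightedDirichlet β)) atTop (𝓝 f) := by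
  have h := tendsto_sum_nat_add fun n : ℕ => ‖f.coeff n‖ ^ 2 * ((n : ℝ) + 1) ^ (2 * β)
  have e : ∀ N, ‖(ofPolynomial (f.taylorPolynomial N) : WeightedDirichlet β) - f‖ ^ 2 =
      ∑' n : ℕ, ‖f.coeff (n + N)‖ ^ 2 * (((n + N : ℕ) : ℝ) + 1) ^ (2 * β) := by
    intro N
    rw [norm_sq_eq, ← (summable_coeff _).sum_add_tsum_nat_add N, Finset.sum_eq_zero, zero_add]
    · refine tsum_congr fun n => ?_
      simp [coeff_sub, coeff_taylorPolynomial]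
    · intro n hn
      simp [coeff_sub, coeff_taylorPolynomial, Finset.mem_range.1 hn]
  rw [tendsto_iff_norm_sub_tendsto_zero]
  have h2 : Tendsto (fun N =>
      √(‖(ofPolynomial (f.taylorPolynomial N) : WeightedDirichlet β) - f‖ ^ 2)) atTop (𝓝 (√0)) := by
    simp_rw [e]
    exact (Real.continuous_sqrt.tendsto 0).comp h
  simpa [Real.sqrt_sq (norm_nonneg _)] using h2

/-! ### The composition operators -/

theorem exists_comp_discFlow_ofPolynomial (hβ : 1 / 2 ≤ β) (p : Polynomial ℂ) (t : ℝ) :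
    ∃ g : WeightedDirichlet β, (∀ n, g.coeff n = PowerSeries.coeff n (polyFlow p t)) ∧
      ∀ z, g z = (ofPolynomial p : WeightedDirichlet β) (discFlow t z) := by
  obtain ⟨K, hK⟩ := exists_isFlowWeight_rpow hβ
  obtain ⟨g, hg⟩ := exists_coeff_eq (β := β) (fun n => PowerSeries.coeff n (polyFlow p t))
    (by simpa only [mul_comm] using
      summable_weight_mul_norm_sq hK (isLocallyGeometric_polyFlow p) t)
  refine ⟨g, congrFun hg, fun z => ?_⟩
  rw [ofPolynomial_apply]
  have h := g.hasSum_coeff z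
  rw [hg] at h
  exact h.unique (hasSum_polyFlow p t z)

/-- Composition with `discFlow t` extends from polynomials to `D_β`: the images of the Taylor
polynomials of `f` form a Cauchy sequence, and point evaluations are continuous. -/
theorem exists_comp_discFlow (hβ : 1 / 2 ≤ β) {K : ℝ}
    (hK : IsFlowWeight (fun n : ℕ => ((n : ℝ) + 1) ^ (2 * β)) K) (t : ℝ)
    (f : WeightedDirichlet β) :
    ∃ g : WeightedDirichlet β, (∀ z, g z = f (discFlow t z)) ∧ ‖g‖ ≤ Real.exp (K * |t|) * ‖f‖ := by
  choose G hGc hGz using fun p : Polynomial ℂ => exists_comp_discFlow_ofPolynomial hβ p t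
  have hβ0 : 0 ≤ β := by linarith
  have hbound : ∀ p, ‖G p‖ ≤ Real.exp (K * |t|) * ‖(ofPolynomial p : WeightedDirichlet β)‖ := by
    intro p
    refine abs_le_of_sq_le_sq' ?_ (by positivity) |>.2
    have h := energy_le_exp_mul hK (isFlowSolution_polyFlow p) (isLocallyGeometric_polyFlow p) t
    simp only [← hGc, polyFlow_zero, mul_comm (_ ^ (2 * β))] at h
    rw [norm_sq_eq, mul_pow, norm_sq_eq, ← Real.exp_nat_mul]
    simpa only [coeff_ofPolynomial, Nat.cast_ofNat, mul_assoc] using h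
  have hsub : ∀ p q, G p - G q = G (p - q) := by
    intro p q
    ext z
    simp [hGz, ofPolynomial_apply]
  have hsub' : ∀ p q : Polynomial ℂ, (ofPolynomial (p - q) : WeightedDirichlet β) =
      ofPolynomial p - ofPolynomial q := by
    intro p q
    exact ext_coeff fun n => by simp [coeff_sub]
  set T : ℕ → Polynomial ℂ := f.taylorPolynomial
  have hT := f.tendsto_ofPolynomial_taylorPolynomial
  have hC : CauchySeq fun N => G (T N) := by
    rw [Metric.cauchySeq_iff']
    intro ε hε
    obtain ⟨N, hN⟩ := Metric.cauchySeq_iff'.1 hT.cauchySeq (ε / Real.exp (K * |t|)) (by positivity)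
    refine ⟨N, fun n hn => ?_⟩
    have h := hN n hn
    rw [dist_eq_norm, lt_div_iff₀' (Real.exp_pos _)] at h
    rw [dist_eq_norm, hsub]
    refine (hbound _).trans_lt ?_
    rwa [hsub']
  obtain ⟨g, hg⟩ := cauchySeq_tendsto_of_complete hC
  refine ⟨g, fun z => ?_, ?_⟩
  · refine tendsto_nhds_unique (tendsto_apply hβ0 hg z) ?_
    simp only [hGz]
    exact tendsto_apply hβ0 hT _
  · exact le_of_tendsto_of_tendsto' hg.norm (hT.norm.const_mul _) fun N => hbound _

theorem exists_isCompositionOperator_discFlow (hβ : 1 / 2 ≤ β) (t : ℝ) :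
    ∃ C : WeightedDirichlet β →L[ℂ] WeightedDirichlet β,
      IsCompositionOperator (discFlow t) C := by
  obtain ⟨K, hK⟩ := exists_isFlowWeight_rpow hβ
  choose G hG hGn using exists_comp_discFlow hβ hK t
  let L : WeightedDirichlet β →ₗ[ℂ] WeightedDirichlet β :=
    { toFun := G
      map_add' := fun f g => by ext z; simp [hG]
      map_smul' := fun c f => by ext z; simp [hG] }
  exact ⟨L.mkContinuous _ hGn, hG⟩

/-- The operator of composition with `discFlow t` on `D_β`. -/
noncomputable def compFlow (hβ : 1 / 2 ≤ β) (t : ℝ) :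
    WeightedDirichlet β →L[ℂ] WeightedDirichlet β :=
  (exists_isCompositionOperator_discFlow hβ t).choose

theorem compFlow_apply (hβ : 1 / 2 ≤ β) (t : ℝ) (f : WeightedDirichlet β) (z : 𝔻) :
    compFlow hβ t f z = f (discFlow t z) :=
  (exists_isCompositionOperator_discFlow hβ t).choose_spec f z

theorem compFlow_add (hβ : 1 / 2 ≤ β) (s t : ℝ) (f : WeightedDirichlet β) :
    compFlow hβ (s + t) f = compFlow hβ s (compFlow hβ t f) := by
  ext z
  simp only [compFlow_apply, ← discFlow_add, add_comm]

theorem compFlow_zero (hβ : 1 / 2 ≤ β) (f : WeightedDirichlet β) : compFlow hβ 0 f = f := by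
  ext z
  rw [compFlow_apply, discFlow_zero]

theorem coeff_compFlow_ofPolynomial (hβ : 1 / 2 ≤ β) (t : ℝ) (p : Polynomial ℂ) (n : ℕ) :
    (compFlow hβ t (ofPolynomial p)).coeff n = PowerSeries.coeff n (polyFlow p t) := by
  obtain ⟨g, hg, hgz⟩ := exists_comp_discFlow_ofPolynomial hβ p t
  have : compFlow hβ t (ofPolynomial p) = g := by ext z; rw [compFlow_apply, hgz]
  rw [this, hg]

/-- The energy estimate on all of `D_β`, for the weights whose energy is finite on `D_β`. -/
theorem weighted_energy_compFlow_le (hβ : 1 / 2 ≤ β) {w : ℕ → ℝ} {K : ℝ} (hw : IsFlowWeight w K)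
    (t : ℝ) (f : WeightedDirichlet β) (hf : Summable fun n => w n * ‖f.coeff n‖ ^ 2) :
    (Summable fun n => w n * ‖(compFlow hβ t f).coeff n‖ ^ 2) ∧
      ∑' n, w n * ‖(compFlow hβ t f).coeff n‖ ^ 2 ≤
        Real.exp (2 * K * |t|) * ∑' n, w n * ‖f.coeff n‖ ^ 2 := by
  have hβ0 : 0 ≤ β := by linarith
  have hnn : ∀ n (c : ℂ), 0 ≤ w n * ‖c‖ ^ 2 := fun n c => mul_nonneg (hw.nonneg n) (by positivity)
  -- partial sums of the energy are continuous on `D_β`, so Taylor polynomials suffice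
  have hpart : ∀ N, ∑ n ∈ Finset.range N, w n * ‖(compFlow hβ t f).coeff n‖ ^ 2 ≤
      Real.exp (2 * K * |t|) * ∑' n, w n * ‖f.coeff n‖ ^ 2 := by
    intro N
    have hlim := ((compFlow hβ t).continuous.tendsto f).comp f.tendsto_ofPolynomial_taylorPolynomial
    refine le_of_tendsto' (tendsto_finsetSum (Finset.range N) fun n _ =>
      ((tendsto_coeff hβ0 hlim n).norm.pow 2).const_mul (w n)) fun M => ?_
    simp only [Function.comp_apply, coeff_compFlow_ofPolynomial]
    set p := f.taylorPolynomial M with hp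
    refine ((summable_weight_mul_norm_sq hw (isLocallyGeometric_polyFlow p) t).sum_le_tsum _
      fun n _ => hnn n _).trans ((energy_le_exp_mul hw (isFlowSolution_polyFlow p)
        (isLocallyGeometric_polyFlow p) t).trans ?_)
    refine mul_le_mul_of_nonneg_left ?_ (Real.exp_pos _).le
    refine Summable.tsum_le_tsum (fun n => ?_)
      (summable_weight_mul_norm_sq hw (isLocallyGeometric_polyFlow p) 0) hf
    rw [polyFlow_zero, hp, coeff_taylorPolynomial]
    split_ifs
    · exact le_rfl
    · simpa using hnn n (f.coeff n)
  exact ⟨summable_of_sum_range_le (fun n => hnn n _) hpart,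
    Real.tsum_le_of_sum_range_le (fun n => hnn n _) hpart⟩

end WeightedDirichlet

/-! ### Universal operators -/

/-- The zero operator is similar to a restriction of a universal operator, so the kernel of a
universal operator is as large as the space and no single functional can separate its points. -/
theorem not_isUniversalOperator_of_functional {H : Type*} [NormedAddCommGroup H] [NormedSpace ℂ H]
    {U : H →L[ℂ] H} (ℓ : H →ₗ[ℂ] ℂ) (hℓ : ∀ x, U x = 0 → ℓ x = 0 → x = 0) {e₀ e₁ : H}
    (he : LinearIndependent ℂ ![e₀, e₁]) : ¬ IsUniversalOperator U := by
  intro h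
  obtain ⟨M, hM, c, -, -, J, hJ⟩ := h 0
  have hU : ∀ x : M, U x = 0 := by
    intro x
    have h1 : U.restrict hM x = 0 := by rw [hJ]; simp
    exact congrArg Subtype.val h1
  have hinj : ∀ y : H, ℓ (J.symm y : M) = 0 → y = 0 := by
    intro y hy
    have h1 : ((J.symm y : M) : H) = 0 := hℓ _ (hU _) hy
    have h2 : J.symm y = 0 := Subtype.ext h1
    simpa using h2
  have h0 := hinj (ℓ (J.symm e₁ : M) • e₀ + (-ℓ (J.symm e₀ : M)) • e₁) (by
    simp; ring)
  rw [LinearIndependent.pair_iff] at he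
  have h1 : e₀ = 0 := hinj e₀ (by simpa using (he _ _ h0).2)
  exact one_ne_zero (he 1 0 (by simp [h1])).1

namespace WeightedDirichlet

variable {β : ℝ}

theorem linearIndependent_ofPolynomial_one_X :
    LinearIndependent ℂ
      ![(ofPolynomial 1 : WeightedDirichlet β), ofPolynomial Polynomial.X] := by
  rw [LinearIndependent.pair_iff]
  intro a b h
  have h0 := congrArg (coeffLM 0) h
  have h1 := congrArg (coeffLM 1) h
  simp only [map_add, map_smul, coeffLM_apply, coeff_ofPolynomial, map_zero] at h0 h1
  simp [Polynomial.coeff_one] at h0 h1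
  exact ⟨h0, h1⟩

/-! ### The Dirichlet seminorm -/

/-- The square of the Dirichlet seminorm, `∑ n |aₙ|²`. -/
noncomputable def dirichletEnergy (f : WeightedDirichlet β) : ℝ :=
  ∑' n : ℕ, (n : ℝ) * ‖f.coeff n‖ ^ 2

theorem natCast_mul_norm_coeff_sq_le (hβ : 1 / 2 ≤ β) (f : WeightedDirichlet β) (n : ℕ) :
    (n : ℝ) * ‖f.coeff n‖ ^ 2 ≤ ‖f.coeff n‖ ^ 2 * ((n : ℝ) + 1) ^ (2 * β) := by
  rw [mul_comm]
  have hn : (0 : ℝ) ≤ n := n.cast_nonneg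
  gcongr
  calc (n : ℝ) ≤ ((n : ℝ) + 1) ^ (1 : ℝ) := by rw [Real.rpow_one]; linarith
    _ ≤ _ := Real.rpow_le_rpow_of_exponent_le (by linarith) (by linarith)

theorem summable_dirichletEnergy (hβ : 1 / 2 ≤ β) (f : WeightedDirichlet β) :
    Summable fun n : ℕ => (n : ℝ) * ‖f.coeff n‖ ^ 2 :=
  Summable.of_nonneg_of_le (fun n => by positivity) (natCast_mul_norm_coeff_sq_le hβ f)
    f.summable_coeff

theorem dirichletEnergy_le_norm_sq (hβ : 1 / 2 ≤ β) (f : WeightedDirichlet β) :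
    dirichletEnergy f ≤ ‖f‖ ^ 2 := by
  rw [norm_sq_eq]
  exact (summable_dirichletEnergy hβ f).tsum_le_tsum (natCast_mul_norm_coeff_sq_le hβ f)
    f.summable_coeff

theorem dirichletEnergy_smul (c : ℂ) (f : WeightedDirichlet β) :
    dirichletEnergy (c • f) = ‖c‖ ^ 2 * dirichletEnergy f := by
  rw [dirichletEnergy, dirichletEnergy, ← tsum_mul_left]
  refine tsum_congr fun n => ?_
  rw [coeff_smul, Pi.smul_apply, smul_eq_mul, norm_mul]
  ring

theorem norm_coeff_succ_sq_le_dirichletEnergy (hβ : 1 / 2 ≤ β) (f : WeightedDirichlet β) (n : ℕ) :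
    ‖f.coeff (n + 1)‖ ^ 2 ≤ dirichletEnergy f := by
  refine le_trans ?_ ((summable_dirichletEnergy hβ f).le_tsum (n + 1) fun m _ => by positivity)
  refine le_mul_of_one_le_left (by positivity) ?_
  push_cast
  linarith [(n.cast_nonneg : (0 : ℝ) ≤ n)]

theorem dirichletEnergy_compFlow_le (hβ : 1 / 2 ≤ β) (t : ℝ) (f : WeightedDirichlet β) :
    dirichletEnergy (compFlow hβ t f) ≤ dirichletEnergy f := by
  simpa [dirichletEnergy] using
    (weighted_energy_compFlow_le hβ isFlowWeight_natCast t f (summable_dirichletEnergy hβ f)).2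

theorem dirichletEnergy_compFlow (hβ : 1 / 2 ≤ β) (t : ℝ) (f : WeightedDirichlet β) :
    dirichletEnergy (compFlow hβ t f) = dirichletEnergy f := by
  refine (dirichletEnergy_compFlow_le hβ t f).antisymm ?_
  have h := dirichletEnergy_compFlow_le hβ (-t) (compFlow hβ t f)
  rwa [← compFlow_add, neg_add_cancel, compFlow_zero] at h

/-- The nonconstant coefficients of `f ∘ discFlow t` tend to zero: `discFlow t` tends to a constant,
which settles polynomials, and by invariance of the Dirichlet seminorm these suffice. -/
theorem tendsto_coeff_succ_compFlow (hβ : 1 / 2 ≤ β) {l : Filter ℝ} {σ : ℝ} (hσ : σ ^ 2 = 1)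
    (hl : Tendsto Real.tanh l (𝓝 σ)) (f : WeightedDirichlet β) (n : ℕ) :
    Tendsto (fun t => (compFlow hβ t f).coeff (n + 1)) l (𝓝 0) := by
  rw [Metric.tendsto_nhds]
  intro ε hε
  obtain ⟨N, hN⟩ := (Metric.tendsto_atTop.1 f.tendsto_ofPolynomial_taylorPolynomial) (ε / 2)
    (by positivity)
  have hN := hN N le_rfl
  set p := f.taylorPolynomial N
  have hp := Metric.tendsto_nhds.1 (tendsto_coeff_polyFlow hσ hl p n) (ε / 2) (by positivity)
  filter_upwards [hp] with t ht
  rw [dist_zero_right] at ht ⊢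
  have h1 : ‖(compFlow hβ t (f - ofPolynomial p)).coeff (n + 1)‖ < ε / 2 := by
    refine lt_of_le_of_lt ?_ hN
    rw [dist_comm, dist_eq_norm]
    refine abs_le_of_sq_le_sq' ?_ (norm_nonneg _) |>.2
    refine (norm_coeff_succ_sq_le_dirichletEnergy hβ _ n).trans ?_
    rw [dirichletEnergy_compFlow]
    exact dirichletEnergy_le_norm_sq hβ _
  rw [map_sub, coeff_sub, coeff_compFlow_ofPolynomial] at h1
  calc _ = ‖((compFlow hβ t f).coeff (n + 1) - PowerSeries.coeff (n + 1) (polyFlow p t)) +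
        PowerSeries.coeff (n + 1) (polyFlow p t)‖ := by rw [sub_add_cancel]
    _ ≤ _ := norm_add_le _ _
    _ < ε / 2 + ε / 2 := add_lt_add h1 ht
    _ = ε := by ring

theorem tendsto_coeff_succ_compFlow_nat_mul (hβ : 1 / 2 ≤ β) {t : ℝ} (ht : t ≠ 0)
    (f : WeightedDirichlet β) (n : ℕ) :
    Tendsto (fun k : ℕ => (compFlow hβ (k * t) f).coeff (n + 1)) atTop (𝓝 0) := by
  rcases ht.lt_or_gt with h | h
  · exact (tendsto_coeff_succ_compFlow hβ (by norm_num) Real.tendsto_tanh_atBot f n).comp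
      (tendsto_natCast_atTop_atTop.atTop_mul_const_of_neg h)
  · exact (tendsto_coeff_succ_compFlow hβ (by norm_num) Real.tendsto_tanh_atTop f n).comp
      (tendsto_natCast_atTop_atTop.atTop_mul_const h)

/-! ### Eigenvectors of the composition operator and of its adjoint -/

theorem compFlow_nat_mul_of_eigenvector (hβ : 1 / 2 ≤ β) {t : ℝ} {μ : ℂ} {f : WeightedDirichlet β}
    (h : compFlow hβ t f = μ • f) (k : ℕ) : compFlow hβ (k * t) f = μ ^ k • f := by
  induction k with
  | zero => simp [compFlow_zero]
  | succ k ih =>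
    rw [Nat.cast_succ, add_mul, one_mul, compFlow_add, h, map_smul, ih, smul_smul, pow_succ']

/-- Eigenvectors are constant: an eigenvalue of modulus less than one contradicts the invariance of
the Dirichlet seminorm, and otherwise the coefficients `μᵏ aₙ` of `f ∘ discFlow (k t)` cannot tend
to zero. -/
theorem coeff_succ_eq_zero_of_eigenvector (hβ : 1 / 2 ≤ β) {t : ℝ} (ht : t ≠ 0) {μ : ℂ}
    {f : WeightedDirichlet β} (h : compFlow hβ t f = μ • f) (n : ℕ) : f.coeff (n + 1) = 0 := by
  rcases lt_or_ge ‖μ‖ 1 with hμ | hμ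
  · have h1 := dirichletEnergy_compFlow hβ t f
    rw [h, dirichletEnergy_smul] at h1
    have h2 := norm_coeff_succ_sq_le_dirichletEnergy hβ f n
    have h3 : ‖μ‖ ^ 2 < 1 := by nlinarith [norm_nonneg μ]
    have h4 : dirichletEnergy f = 0 := by
      have : (1 - ‖μ‖ ^ 2) * dirichletEnergy f = 0 := by linarith
      exact (mul_eq_zero.1 this).resolve_left (by linarith)
    rw [h4] at h2
    exact norm_eq_zero.1 (pow_eq_zero_iff two_ne_zero |>.1 (h2.antisymm (by positivity)))
  · have h1 := (tendsto_coeff_succ_compFlow_nat_mul hβ ht f n).norm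
    rw [norm_zero] at h1
    refine norm_le_zero_iff.1 (ge_of_tendsto' h1 fun k => ?_)
    rw [compFlow_nat_mul_of_eigenvector hβ h, coeff_smul, Pi.smul_apply, smul_eq_mul, norm_mul,
      norm_pow]
    exact le_mul_of_one_le_left (norm_nonneg _) (one_le_pow₀ hμ)

theorem eq_smul_one_of_coeff_succ_eq_zero {f : WeightedDirichlet β}
    (h : ∀ n, f.coeff (n + 1) = 0) : f = f.coeff 0 • ofPolynomial 1 := by
  refine ext_coeff fun n => ?_
  rw [coeff_smul, Pi.smul_apply, coeff_ofPolynomial]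
  rcases n with _ | n
  · simp
  · simp [h, Polynomial.coeff_one]

/-- A bounded family whose coefficients tend to zero tends weakly to zero. -/
theorem tendsto_inner_of_tendsto_coeff {ι : Type*} {l : Filter ι} {u : ι → WeightedDirichlet β}
    {M : ℝ} (hM : ∀ i, ‖u i‖ ≤ M) (h : ∀ n, Tendsto (fun i => (u i).coeff n) l (𝓝 0))
    (g : WeightedDirichlet β) : Tendsto (fun i => inner ℂ (u i) g) l (𝓝 0) := by
  have hpoly : ∀ p : Polynomial ℂ, Tendsto (fun i => inner ℂ (u i) (ofPolynomial p)) l (𝓝 0) := by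
    intro p
    have e : ∀ i, inner ℂ (u i) (ofPolynomial p) = ∑ n ∈ p.support,
        conj ((u i).coeff n) * p.coeff n * (((n : ℝ) + 1) ^ (2 * β) : ℝ) := by
      intro i
      rw [inner_def, tsum_eq_sum (s := p.support)]
      · simp
      · intro n hn
        simp [Polynomial.notMem_support_iff.1 hn]
    simp_rw [e]
    have := tendsto_finsetSum (x := l) p.support fun n _ =>
      (((Complex.continuous_conj.tendsto 0).comp (h n)).mul_const (p.coeff n)).mul_const
        ((((n : ℝ) + 1) ^ (2 * β) : ℝ) : ℂ)
    simpa [Function.comp_def] using this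
  rw [Metric.tendsto_nhds]
  intro ε hε
  have hM1 : 0 < |M| + 1 := by positivity
  obtain ⟨N, hN⟩ := (Metric.tendsto_atTop.1 g.tendsto_ofPolynomial_taylorPolynomial)
    (ε / 2 / (|M| + 1)) (by positivity)
  have hN := hN N le_rfl
  rw [dist_comm, dist_eq_norm, lt_div_iff₀' hM1] at hN
  filter_upwards [Metric.tendsto_nhds.1 (hpoly (g.taylorPolynomial N)) (ε / 2) (by positivity)]
    with i hi
  rw [dist_zero_right] at hi ⊢
  set p := g.taylorPolynomial N
  have h1 : ‖inner ℂ (u i) (g - ofPolynomial p)‖ < ε / 2 := by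
    refine ((norm_inner_le_norm _ _).trans ?_).trans_lt hN
    gcongr
    exact (hM i).trans ((le_abs_self M).trans (by linarith))
  rw [inner_sub_right] at h1
  calc _ = ‖(inner ℂ (u i) g - inner ℂ (u i) (ofPolynomial p)) +
        inner ℂ (u i) (ofPolynomial p)‖ := by
        rw [sub_add_cancel]
    _ ≤ _ := norm_add_le _ _
    _ < ε / 2 + ε / 2 := add_lt_add h1 hi
    _ = ε := by ring

/-- Modulo constants the Dirichlet seminorm is equivalent to the norm of `D_{1/2}`. -/
theorem norm_sub_const_sq_le (f : WeightedDirichlet (1 / 2)) :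
    ‖f - f.coeff 0 • ofPolynomial 1‖ ^ 2 ≤ 2 * dirichletEnergy f := by
  rw [norm_sq_eq, dirichletEnergy, ← tsum_mul_left]
  refine (summable_coeff _).tsum_le_tsum (fun n => ?_)
    ((summable_dirichletEnergy le_rfl f).mul_left 2)
  rw [coeff_sub, coeff_smul, Pi.smul_apply, coeff_ofPolynomial]
  rcases n with _ | n
  · simp
  · simp [Polynomial.coeff_one]
    nlinarith [mul_nonneg (n.cast_nonneg : (0 : ℝ) ≤ n) (sq_nonneg ‖f.coeff (n + 1)‖)]

theorem inner_sub_const {f g : WeightedDirichlet β} (hg : g.coeff 0 = 0) :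
    inner ℂ (f - f.coeff 0 • ofPolynomial 1) g = inner ℂ f g := by
  have h : inner ℂ (ofPolynomial 1 : WeightedDirichlet β) g = 0 := by
    rw [inner_def]
    convert tsum_zero with n
    rcases n with _ | n <;> simp [Polynomial.coeff_one, hg]
  rw [inner_sub_left, inner_smul_left, h, mul_zero, sub_zero]

/-- On the Dirichlet space the orbits `f ∘ discFlow (k t)` stay bounded modulo constants and tend
weakly to zero modulo constants, so a functional that kills the constants is no eigenvector of the
adjoint. -/
theorem eq_zero_of_adjoint_eigenvector {t : ℝ} (ht : t ≠ 0) {ν : ℂ} {g : WeightedDirichlet (1 / 2)}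
    (hg : ContinuousLinearMap.adjoint (compFlow le_rfl t) g = ν • g) (hg0 : g.coeff 0 = 0) :
    g = 0 := by
  have hstep : ∀ f, inner ℂ (compFlow le_rfl t f) g = ν * inner ℂ f g := by
    intro f
    rw [← ContinuousLinearMap.adjoint_inner_right, hg, inner_smul_right]
  have hk : ∀ (k : ℕ) f, inner ℂ (compFlow le_rfl (k * t) f) g = ν ^ k * inner ℂ f g := by
    intro k
    induction k with
    | zero => simp [compFlow_zero]
    | succ k ih =>
      intro f
      rw [Nat.cast_succ, add_mul, one_mul, add_comm, compFlow_add, hstep, ih]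
      ring
  set u : ℝ → WeightedDirichlet (1 / 2) → WeightedDirichlet (1 / 2) := fun s f =>
    compFlow le_rfl s f - (compFlow le_rfl s f).coeff 0 • ofPolynomial 1 with hu
  have hub : ∀ s f, ‖u s f‖ ≤ √(2 * dirichletEnergy f) := by
    intro s f
    refine Real.le_sqrt_of_sq_le ((norm_sub_const_sq_le _).trans ?_)
    rw [dirichletEnergy_compFlow]
  have hzero : ∀ f, inner ℂ f g = 0 := by
    intro f
    rcases lt_or_ge ‖ν‖ 1 with hν | hν
    · -- apply the relation to `f ∘ discFlow (-k t)`, which is bounded modulo constants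
      have hlim : Tendsto (fun k : ℕ => ‖ν‖ ^ k * (√(2 * dirichletEnergy f) * ‖g‖)) atTop
          (𝓝 0) := by
        simpa using (tendsto_pow_atTop_nhds_zero_of_lt_one (norm_nonneg _) hν).mul_const
          (√(2 * dirichletEnergy f) * ‖g‖)
      refine norm_le_zero_iff.1 (ge_of_tendsto' hlim fun k => ?_)
      have h1 := hk k (compFlow le_rfl (-(k * t)) f)
      rw [← compFlow_add, add_neg_cancel, compFlow_zero] at h1
      rw [h1, norm_mul, norm_pow]
      gcongr
      rw [← inner_sub_const hg0]
      refine (norm_inner_le_norm _ _).trans ?_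
      gcongr
      exact hub _ _
    · have hlim : Tendsto (fun k : ℕ => inner ℂ (u (k * t) f) g) atTop (𝓝 0) := by
        refine tendsto_inner_of_tendsto_coeff (fun k => hub _ f) (fun n => ?_) g
        rcases n with _ | n
        · simp [hu, coeff_sub, coeff_smul]
        · simpa [hu, coeff_sub, coeff_smul, Polynomial.coeff_one] using
            tendsto_coeff_succ_compFlow_nat_mul le_rfl ht f n
      refine norm_le_zero_iff.1 (ge_of_tendsto' (by simpa using hlim.norm) fun k => ?_)
      rw [inner_sub_const hg0, hk, norm_mul, norm_pow]
      exact le_mul_of_one_le_left (norm_nonneg _) (one_le_pow₀ hν)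
  exact inner_self_eq_zero.1 (hzero g)

/-! ### The spectrum on the Dirichlet space -/

/-- The operators `f ↦ f ∘ discFlow t` grow subexponentially on the Dirichlet space. -/
theorem norm_compFlow_sq_le {ε : ℝ} (h0 : 0 < ε) (h1 : ε ≤ 1) (t : ℝ) :
    ‖compFlow (β := 1 / 2) le_rfl t‖ ^ 2 ≤ 2 / ε ^ 2 * Real.exp (2 * ε * |t|) := by
  -- the energy with these weights is the square of an equivalent norm, and grows at rate `2 ε`
  set w : ℕ → ℝ := fun n => if n = 0 then ε ^ 2 else (n : ℝ) with hw
  have hε1 : ε ^ 2 ≤ 1 := by nlinarith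
  have hle : ∀ n : ℕ, w n ≤ (n : ℝ) + 1 := by
    rintro (_ | n)
    · simpa [hw] using abs_le.2 ⟨by linarith, h1⟩
    · simp [hw]
  have hge : ∀ n : ℕ, (n : ℝ) + 1 ≤ 2 / ε ^ 2 * w n := by
    rintro (_ | n)
    · simp only [hw, if_true]
      rw [div_mul_cancel₀ _ (by positivity)]
      norm_num
    · have h2 : 2 ≤ 2 / ε ^ 2 := by rw [le_div_iff₀ (by positivity)]; linarith
      have hn : (0 : ℝ) ≤ n := n.cast_nonneg
      have h3 : (2 : ℝ) * (n + 1) ≤ 2 / ε ^ 2 * (n + 1) := by gcongr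
      simp [hw]
      linarith
  have hnorm : ∀ f : WeightedDirichlet (1 / 2),
      ‖f‖ ^ 2 = ∑' n : ℕ, ((n : ℝ) + 1) * ‖f.coeff n‖ ^ 2 := by
    intro f
    rw [norm_sq_eq]
    refine tsum_congr fun n => ?_
    norm_num
    ring
  have hsum : ∀ f : WeightedDirichlet (1 / 2),
      Summable fun n : ℕ => ((n : ℝ) + 1) * ‖f.coeff n‖ ^ 2 := by
    intro f
    refine f.summable_coeff.congr fun n => ?_
    norm_num
    ring
  have hwn := (isFlowWeight_dirichlet_add h0.le h1)
  have hmain : ∀ f, ‖compFlow (β := 1 / 2) le_rfl t f‖ ^ 2 ≤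
      2 / ε ^ 2 * Real.exp (2 * ε * |t|) * ‖f‖ ^ 2 := by
    intro f
    have hwf : Summable fun n => w n * ‖f.coeff n‖ ^ 2 :=
      Summable.of_nonneg_of_le (fun n => mul_nonneg (hwn.nonneg n) (by positivity))
        (fun n => mul_le_mul_of_nonneg_right (hle n) (by positivity)) (hsum f)
    obtain ⟨hs, hE⟩ := weighted_energy_compFlow_le le_rfl hwn t f hwf
    calc _ ≤ ∑' n, 2 / ε ^ 2 * (w n * ‖(compFlow (β := 1 / 2) le_rfl t f).coeff n‖ ^ 2) := by
          rw [hnorm]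
          refine (hsum _).tsum_le_tsum (fun n => ?_) (hs.mul_left _)
          rw [← mul_assoc]
          exact mul_le_mul_of_nonneg_right (hge n) (by positivity)
      _ ≤ 2 / ε ^ 2 * (Real.exp (2 * ε * |t|) * ∑' n, w n * ‖f.coeff n‖ ^ 2) := by
          rw [tsum_mul_left]
          gcongr
      _ ≤ 2 / ε ^ 2 * (Real.exp (2 * ε * |t|) * ‖f‖ ^ 2) := by
          gcongr
          rw [hnorm]
          exact hwf.tsum_le_tsum
            (fun n => mul_le_mul_of_nonneg_right (hle n) (by positivity)) (hsum f)
      _ = _ := by ring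
  have hb : ‖compFlow (β := 1 / 2) le_rfl t‖ ≤ √(2 / ε ^ 2 * Real.exp (2 * ε * |t|)) := by
    refine ContinuousLinearMap.opNorm_le_bound _ (Real.sqrt_nonneg _) fun f => ?_
    refine abs_le_of_sq_le_sq' ?_ (by positivity) |>.2
    rw [mul_pow, Real.sq_sqrt (by positivity)]
    exact hmain f
  calc _ ≤ √(2 / ε ^ 2 * Real.exp (2 * ε * |t|)) ^ 2 := by gcongr
    _ = _ := Real.sq_sqrt (by positivity)

theorem compFlow_pow (hβ : 1 / 2 ≤ β) (t : ℝ) (k : ℕ) :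
    compFlow hβ t ^ k = compFlow hβ (k * t) := by
  induction k with
  | zero => ext f; simp [compFlow_zero]
  | succ k ih =>
    ext f
    rw [pow_succ, ih, Nat.cast_succ, add_mul, one_mul, mul_apply_eq_comp, compFlow_add]

theorem norm_le_one_of_mem_spectrum_compFlow {t : ℝ} {μ : ℂ}
    (h : μ ∈ spectrum ℂ (compFlow (β := 1 / 2) le_rfl t)) : ‖μ‖ ≤ 1 := by
  have hε : ∀ ε : ℝ, 0 < ε → ε ≤ 1 → ‖μ‖ ^ 2 ≤ Real.exp (2 * ε * |t|) := by
    intro ε h0 h1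
    by_contra! hlt
    have hpos := Real.exp_pos (2 * ε * |t|)
    have hk : ∀ k : ℕ, (‖μ‖ ^ 2 / Real.exp (2 * ε * |t|)) ^ k ≤ 2 / ε ^ 2 := by
      intro k
      have hmem := spectrum.pow_mem_pow (compFlow (β := 1 / 2) le_rfl t) k h
      rw [compFlow_pow] at hmem
      have h2 := spectrum.norm_le_norm_mul_of_mem hmem
      have h3 : ‖μ ^ k‖ ≤ ‖compFlow (β := 1 / 2) le_rfl (k * t)‖ :=
        h2.trans (mul_le_of_le_one_right (norm_nonneg _) ContinuousLinearMap.norm_id_le)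
      rw [div_pow, div_le_iff₀ (by positivity), ← Real.exp_nat_mul]
      calc (‖μ‖ ^ 2) ^ k = ‖μ ^ k‖ ^ 2 := by rw [norm_pow]; ring
        _ ≤ ‖compFlow (β := 1 / 2) le_rfl (k * t)‖ ^ 2 := by gcongr
        _ ≤ _ := norm_compFlow_sq_le h0 h1 _
        _ = _ := by
          rw [abs_mul, Nat.abs_cast]
          congr 2
          ring
    have ht := tendsto_pow_atTop_atTop_of_one_lt ((one_lt_div hpos).2 hlt)
    obtain ⟨k, hk'⟩ := (ht.eventually_gt_atTop (2 / ε ^ 2)).exists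
    exact (hk k).not_gt hk'
  have hlim : Tendsto (fun ε : ℝ => Real.exp (2 * ε * |t|)) (𝓝[>] 0) (𝓝 1) := by
    have hc : Continuous fun ε : ℝ => Real.exp (2 * ε * |t|) := by fun_prop
    simpa using (hc.tendsto 0).mono_left nhdsWithin_le_nhds
  have h2 : ‖μ‖ ^ 2 ≤ 1 := by
    refine ge_of_tendsto hlim ?_
    filter_upwards [Ioc_mem_nhdsGT (zero_lt_one (α := ℝ))] with ε hεm
    exact hε ε hεm.1 hεm.2
  exact (sq_le_one_iff₀ (norm_nonneg _)).1 h2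

theorem norm_eq_one_of_mem_spectrum_compFlow {t : ℝ} {μ : ℂ}
    (h : μ ∈ spectrum ℂ (compFlow (β := 1 / 2) le_rfl t)) : ‖μ‖ = 1 := by
  let U : (WeightedDirichlet (1 / 2) →L[ℂ] WeightedDirichlet (1 / 2))ˣ :=
    { val := compFlow le_rfl t
      inv := compFlow le_rfl (-t)
      val_inv := by
        ext f : 1
        rw [mul_apply_eq_comp, ← compFlow_add, add_neg_cancel, compFlow_zero]; rfl
      inv_val := by
        ext f : 1
        rw [mul_apply_eq_comp, ← compFlow_add, neg_add_cancel, compFlow_zero]; rfl }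
  have hμ : μ ≠ 0 := by
    rintro rfl
    exact spectrum.zero_notMem ℂ U.isUnit h
  have hinv := (spectrum.inv_mem_iff (r := Units.mk0 μ hμ) (a := U)).1 h
  have h1 : ‖μ⁻¹‖ ≤ 1 := norm_le_one_of_mem_spectrum_compFlow (t := -t) hinv
  rw [norm_inv] at h1
  exact (norm_le_one_of_mem_spectrum_compFlow h).antisymm
    ((inv_le_one₀ (norm_pos_iff.2 hμ)).1 h1)

/-- The functional `∑ᵢ (-1)ⁱ (N choose i) a₂ᵢ₊₁`. On `z ∘ discFlow t`, whose odd coefficients are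
`(1 - x²) x²ⁱ` with `x = tanh t`, it takes the value `(1 - x²)^(N + 1)`, which has a sharp peak at
`t = 0` for large `N`. -/
noncomputable def peakFunctional (N : ℕ) : WeightedDirichlet β →ₗ[ℂ] ℂ :=
  ∑ i ∈ Finset.range (N + 1), ((-1 : ℂ) ^ i * (N.choose i : ℂ)) • coeffLM (2 * i + 1)

theorem peakFunctional_apply (N : ℕ) (f : WeightedDirichlet β) : peakFunctional N f =
    ∑ i ∈ Finset.range (N + 1), ((-1 : ℂ) ^ i * (N.choose i : ℂ)) * f.coeff (2 * i + 1) := by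
  simp [peakFunctional, coeffLM_apply]

theorem peakFunctional_compFlow_X (hβ : 1 / 2 ≤ β) (N : ℕ) (t : ℝ) :
    peakFunctional N (compFlow hβ t (ofPolynomial Polynomial.X)) =
      (((Real.cosh t ^ 2)⁻¹ ^ (N + 1) : ℝ) : ℂ) := by
  have e : polyFlow Polynomial.X t = mobiusSeries t := Polynomial.aeval_X _
  simp only [peakFunctional_apply, coeff_compFlow_ofPolynomial, e, coeff_succ_mobiusSeries]
  rw [← Real.one_sub_tanh_sq]
  push_cast
  generalize Complex.tanh t = τ
  have h := add_pow (-τ ^ 2) 1 N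
  rw [show (1 : ℂ) - τ ^ 2 = -τ ^ 2 + 1 by ring, pow_succ _ N, h, Finset.sum_mul]
  refine Finset.sum_congr rfl fun i _ => ?_
  rw [neg_pow τ (2 * i), pow_mul (-1 : ℂ), neg_one_sq, one_pow, neg_pow (τ ^ 2), pow_mul]
  ring

theorem cosh_pow_le_cosh_nat_mul {t : ℝ} (ht : 0 ≤ t) (k : ℕ) :
    Real.cosh t ^ k ≤ Real.cosh (k * t) := by
  induction k with
  | zero => simp
  | succ k ih =>
    rw [Nat.cast_succ, add_mul, one_mul, Real.cosh_add, pow_succ]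
    have h1 : 0 ≤ Real.sinh (k * t) * Real.sinh t :=
      mul_nonneg (Real.sinh_nonneg_iff.2 (by positivity)) (Real.sinh_nonneg_iff.2 ht)
    have h2 := mul_le_mul_of_nonneg_right ih (Real.cosh_pos t).le
    linarith

/-- If `u` solved `(μ - C) u = z` with `|μ| = 1`, then the sequence `μ⁻ᵏ Λ (Cᵏ u)`, which tends to
zero at `±∞` for each of the functionals `Λ = peakFunctional N`, would jump by `1` in modulus at
`k = 0` and vary arbitrarily little otherwise. -/
theorem mem_spectrum_compFlow (hβ : 1 / 2 ≤ β) {t : ℝ} (ht : 0 < t) {μ : ℂ} (hμ : ‖μ‖ = 1) :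
    μ ∈ spectrum ℂ (compFlow hβ t) := by
  have hμ0 : μ ≠ 0 := by rintro rfl; simp at hμ
  intro hunit
  obtain ⟨u, hu⟩ := (ContinuousLinearMap.isUnit_iff_bijective.1 hunit).2
    (ofPolynomial Polynomial.X)
  have hu' : μ • u - compFlow hβ t u = ofPolynomial Polynomial.X := by
    rw [← hu]; simp [Algebra.algebraMap_eq_smul_one]
  have hcosh : 1 < Real.cosh t := Real.one_lt_cosh.2 ht.ne'
  set q₀ : ℝ := (Real.cosh t ^ 2)⁻¹ with hq₀
  have hq₀0 : 0 < q₀ := by positivity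
  have hq₀1 : q₀ < 1 := inv_lt_one_of_one_lt₀ (one_lt_pow₀ hcosh two_ne_zero)
  obtain ⟨N, hN⟩ := exists_pow_lt_of_lt_one (show (0 : ℝ) < 1 / 3 by norm_num) hq₀1
  set q : ℝ := q₀ ^ (N + 1) with hq
  have hq0 : 0 < q := by positivity
  have hq3 : q < 1 / 3 :=
    (pow_le_pow_of_le_one hq₀0.le hq₀1.le (Nat.le_succ N)).trans_lt hN
  have hb : ∀ k : ℕ, (Real.cosh (k * t) ^ 2)⁻¹ ^ (N + 1) ≤ q ^ k := by
    intro k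
    rw [hq, hq₀, ← pow_mul, mul_comm (N + 1) k, pow_mul]
    gcongr
    rw [inv_pow, ← pow_mul, mul_comm 2 k, pow_mul]
    gcongr
    exact cosh_pow_le_cosh_nat_mul ht.le k
  set x : ℤ → ℂ := fun k => μ ^ (-k) * peakFunctional N (compFlow hβ (k * t) u) with hx
  have hμz : ∀ k : ℤ, ‖μ ^ k‖ = 1 := fun k => by rw [norm_zpow, hμ, one_zpow]
  have hjump : ∀ k : ℤ, dist (x k) (x (k + 1)) = (Real.cosh (k * t) ^ 2)⁻¹ ^ (N + 1) := by
    intro k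
    have h1 : x k - x (k + 1) = μ ^ (-(k + 1)) *
        peakFunctional N (compFlow hβ (k * t) (ofPolynomial Polynomial.X)) := by
      rw [← hu', map_sub, map_sub, map_smul, map_smul, ← compFlow_add]
      simp only [hx]
      push_cast
      rw [add_mul, one_mul, smul_eq_mul, mul_sub, ← mul_assoc, ← zpow_add_one₀ hμ0]
      congr 3
      ring
    rw [dist_eq_norm, h1, norm_mul, hμz, one_mul, peakFunctional_compFlow_X, Complex.norm_real,
      Real.norm_of_nonneg (by positivity)]
  have hlim : ∀ s : ℝ, s ≠ 0 →
      Tendsto (fun k : ℕ => peakFunctional N (compFlow hβ (k * s) u)) atTop (𝓝 0) := by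
    intro s hs
    simp only [peakFunctional_apply]
    simpa using tendsto_finsetSum (x := atTop) (Finset.range (N + 1)) fun i _ =>
      (tendsto_coeff_succ_compFlow_nat_mul hβ hs u (2 * i)).const_mul
        ((-1 : ℂ) ^ i * (N.choose i : ℂ))
  have hxlim : ∀ y : ℕ → ℤ, ∀ s : ℝ, s ≠ 0 → (∀ k : ℕ, (y k : ℝ) * t = k * s) →
      Tendsto (fun k => x (y k)) atTop (𝓝 0) := by
    intro y s hs hy
    rw [tendsto_zero_iff_norm_tendsto_zero]
    have h := (hlim s hs).norm
    rw [norm_zero] at h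
    refine h.congr fun k => ?_
    simp only [hx]
    rw [norm_mul, hμz, one_mul, hy]
  have hplus : dist (x 1) 0 ≤ q / (1 - q) := by
    have h0 := hxlim (fun k => (k : ℤ)) t ht.ne' (fun k => by simp)
    have h1 : Tendsto (fun k : ℕ => x ((k : ℤ) + 1)) atTop (𝓝 0) := by
      simpa using (tendsto_add_atTop_iff_nat 1).2 h0
    have := dist_le_of_le_geometric_of_tendsto₀ q q (by linarith) (fun k : ℕ => ?_) h1
    · simpa using this
    · have h2 := hjump ((k : ℤ) + 1)
      have h3 := hb (k + 1)
      push_cast at h2 h3 ⊢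
      rw [h2, ← pow_succ']
      exact h3
  have hminus : dist (x 0) 0 ≤ q / (1 - q) := by
    have h1 := hxlim (fun k => -(k : ℤ)) (-t) (neg_ne_zero.2 ht.ne') (fun k => by simp)
    have := dist_le_of_le_geometric_of_tendsto₀ q q (by linarith) (fun k : ℕ => ?_) h1
    · simpa using this
    · have h2 := hjump (-((k : ℤ) + 1))
      have h3 := hb (k + 1)
      rw [dist_comm]
      rw [show -((k : ℤ) + 1) + 1 = -(k : ℤ) by ring] at h2
      push_cast at h2 h3 ⊢
      rw [h2, ← pow_succ', neg_mul, Real.cosh_neg]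
      exact h3
  have hone : dist (x 0) (x 1) = 1 := by
    have h := hjump 0
    simpa using h
  have hlt : q / (1 - q) < 1 / 2 := by
    rw [div_lt_iff₀ (by linarith)]
    linarith
  have := dist_triangle_right (x 0) (x 1) 0
  linarith

theorem spectrum_compFlow {t : ℝ} (ht : 0 < t) :
    spectrum ℂ (compFlow (β := 1 / 2) le_rfl t) = Metric.sphere (0 : ℂ) 1 := by
  ext μ
  rw [mem_sphere_zero_iff_norm]
  exact ⟨norm_eq_one_of_mem_spectrum_compFlow, mem_spectrum_compFlow le_rfl ht⟩

/-! ### Non-universality and eigenvalues -/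

theorem not_isUniversalOperator_compFlow_sub (hβ : 1 / 2 ≤ β) {t : ℝ} (ht : t ≠ 0) (μ : ℂ) :
    ¬ IsUniversalOperator (compFlow hβ t - μ • ContinuousLinearMap.id ℂ _) := by
  refine not_isUniversalOperator_of_functional (coeffLM 0) (fun f hf hf0 => ?_)
    linearIndependent_ofPolynomial_one_X
  have h : compFlow hβ t f = μ • f := sub_eq_zero.1 hf
  rw [eq_smul_one_of_coeff_succ_eq_zero (coeff_succ_eq_zero_of_eigenvector hβ ht h),
    ← coeffLM_apply, hf0, zero_smul]

theorem not_isUniversalOperator_adjoint_compFlow_sub {t : ℝ} (ht : t ≠ 0) (ν : ℂ) :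
    ¬ IsUniversalOperator (ContinuousLinearMap.adjoint (compFlow (β := 1 / 2) le_rfl t) -
      ν • ContinuousLinearMap.id ℂ _) :=
  not_isUniversalOperator_of_functional (coeffLM 0)
    (fun _ hf hf0 => eq_zero_of_adjoint_eigenvector ht (sub_eq_zero.1 hf) hf0)
    linearIndependent_ofPolynomial_one_X

theorem compFlow_smul_one (hβ : 1 / 2 ≤ β) (t : ℝ) (c : ℂ) :
    compFlow hβ t (c • ofPolynomial 1) = c • ofPolynomial 1 := by
  ext z
  simp [compFlow_apply, ofPolynomial_apply]

theorem ofPolynomial_one_ne_zero : (ofPolynomial 1 : WeightedDirichlet β) ≠ 0 := fun h => by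
  simpa [coeffLM_apply, coeff_zero] using congrArg (coeffLM 0) h

theorem compFlow_eq_self_iff (hβ : 1 / 2 ≤ β) {t : ℝ} (ht : t ≠ 0)
    (f : WeightedDirichlet β) : compFlow hβ t f = f ↔ ∃ c : ℂ, f = c • ofPolynomial 1 := by
  refine ⟨fun h => ⟨_, eq_smul_one_of_coeff_succ_eq_zero
    (coeff_succ_eq_zero_of_eigenvector hβ ht (μ := 1) (by rwa [one_smul]))⟩, ?_⟩
  rintro ⟨c, rfl⟩
  exact compFlow_smul_one hβ t c

theorem hasEigenvalue_compFlow_iff (hβ : 1 / 2 ≤ β) {t : ℝ} (ht : t ≠ 0) (μ : ℂ) :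
    Module.End.HasEigenvalue (compFlow hβ t : WeightedDirichlet β →ₗ[ℂ] WeightedDirichlet β) μ ↔
      μ = 1 := by
  constructor
  · intro h
    obtain ⟨f, hf⟩ := h.exists_hasEigenvector
    have hfe : compFlow hβ t f = μ • f := hf.apply_eq_smul
    have hfix : compFlow hβ t f = f := by
      rw [compFlow_eq_self_iff hβ ht]
      exact ⟨_, eq_smul_one_of_coeff_succ_eq_zero (coeff_succ_eq_zero_of_eigenvector hβ ht hfe)⟩
    have h1 : (μ - 1) • f = 0 := by rw [sub_smul, one_smul, ← hfe, hfix, sub_self]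
    exact sub_eq_zero.1 ((smul_eq_zero.1 h1).resolve_right hf.2)
  · rintro rfl
    refine Module.End.hasEigenvalue_of_hasEigenvector (x := ofPolynomial 1)
      ⟨Module.End.mem_eigenspace_iff.2 ?_, ofPolynomial_one_ne_zero⟩
    simpa using compFlow_smul_one hβ t 1

theorem finrank_eigenspace_compFlow_one (hβ : 1 / 2 ≤ β) {t : ℝ} (ht : t ≠ 0) :
    Module.finrank ℂ (Module.End.eigenspace
      (compFlow hβ t : WeightedDirichlet β →ₗ[ℂ] WeightedDirichlet β) 1) = 1 := by
  have e : Module.End.eigenspace (compFlow hβ t : WeightedDirichlet β →ₗ[ℂ] WeightedDirichlet β) 1 =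
      Submodule.span ℂ {ofPolynomial 1} := by
    ext f
    rw [Module.End.mem_eigenspace_iff, one_smul, Submodule.mem_span_singleton]
    exact (compFlow_eq_self_iff hβ ht f).trans (exists_congr fun c => eq_comm)
  rw [e, finrank_span_singleton ofPolynomial_one_ne_zero]

end WeightedDirichlet

theorem mainTheorem10 (r : ℝ) (hr0 : 0 < r) (hr1 : r < 1) (β : ℝ) (hβ : 1 / 2 ≤ β) :
    ∃ C : WeightedDirichlet β →L[ℂ] WeightedDirichlet β,
      WeightedDirichlet.IsCompositionOperator (hyperbolicAut r hr0 hr1) C ∧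
      (∀ μ : ℂ, ¬ IsUniversalOperator (C - μ • ContinuousLinearMap.id ℂ _)) ∧
      (β = 1 / 2 →
        spectrum ℂ C = Metric.sphere (0 : ℂ) 1 ∧
        ∀ μ : ℂ, ¬ IsUniversalOperator
          (ContinuousLinearMap.adjoint C - (starRingEnd ℂ μ) • ContinuousLinearMap.id ℂ _)) ∧
      (1 / 2 < β →
        (∀ μ : ℂ, Module.End.HasEigenvalue (C : WeightedDirichlet β →ₗ[ℂ] WeightedDirichlet β) μ ↔
          μ = 1) ∧
        (∀ f : WeightedDirichlet β, C f = f ↔ ∃ c : ℂ, ∀ z, f z = c) ∧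
        Module.finrank ℂ
          (Module.End.eigenspace (C : WeightedDirichlet β →ₗ[ℂ] WeightedDirichlet β) 1) = 1) := by
  have ht : 0 < Real.artanh r := Real.artanh_pos ⟨hr0, hr1⟩
  refine ⟨WeightedDirichlet.compFlow hβ (Real.artanh r), ?_,
    WeightedDirichlet.not_isUniversalOperator_compFlow_sub hβ ht.ne', ?_, fun _ =>
    ⟨WeightedDirichlet.hasEigenvalue_compFlow_iff hβ ht.ne', fun f => ?_,
      WeightedDirichlet.finrank_eigenspace_compFlow_one hβ ht.ne'⟩⟩
  · rw [hyperbolicAut_eq_discFlow]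
    exact WeightedDirichlet.compFlow_apply hβ _
  · rintro rfl
    exact ⟨WeightedDirichlet.spectrum_compFlow ht, fun μ =>
      WeightedDirichlet.not_isUniversalOperator_adjoint_compFlow_sub ht.ne' _⟩
  · rw [WeightedDirichlet.compFlow_eq_self_iff hβ ht.ne']
    refine exists_congr fun c => ⟨?_, fun h => ?_⟩
    · rintro rfl z
      simp [WeightedDirichlet.ofPolynomial_apply]
    · ext z
      simp [WeightedDirichlet.ofPolynomial_apply, h z]
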